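/- Let $X$ be a (real or complex) Banach space, let $A:D(A)\subseteq X\to X$ be a closed and densely defined linear operator, let $1\le p<\infty$, and let $\Phi:W^{1,p}([-1,0],X)\to X$ be a bounded linear operator. For $u:[-1,\infty)\to X$ and $t\ge 0$ let $u_t:[-1,0]\to X$, $u_t(\sigma):=u(t+\sigma)$. Let $\mathcal E:=X\times L^p([-1,0],X)$ and let $\mathcal A$ be the operator on $\mathcal E$ given by $$\mathcal A\binom{x}{f}:=\binom{Ax+\Phi f}{f'},\qquad D(\mathcal A):=\left\{\binom{x}{f}\in D(A)\times W^{1,p}([-1,0],X)\;:\; f(0)=x\right\},$$ where $f'$ is the weak derivative of $f$ and $f(0)$ is the value at $0$ of the continuous representative of $f$. For $\binom xf\in\mathcal E$, a classical solution of the delay equation $$\text{(DE)}\qquad u'(t)=Au(t)+\Phi u_t\quad (t\ge 0),\qquad u(0)=x,\qquad u_0=f$$ is a function $u:[-1,\infty)\to X$ such that $u\in C([-1,\infty),X)\cap C^1([0,\infty),X)$, $u(t)\in D(A)$ and $u_t\in W^{1,p}([-1,0],X)$ for all $t\ge 0$, and $u$ satisfies (DE) for all $t\ge 0$ (the identity $u_0=f$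 is meant almost everywhere on $[-1,0]$). (DE) is called well-posed if 1. for every $\binom xf\in D(\mathcal A)$ there is a unique classical solution $u(x,f,\cdot)$ of (DE), and 2. whenever a sequence $\binom{x_n}{f_n}$ in $D(\mathcal A)$ converges in $\mathcal E$ to some $\binom xf\in D(\mathcal A)$, then $u(x_n,f_n,t)$ converges to $u(x,f,t)$ uniformly for $t$ in compact subintervals of $[0,\infty)$. **Theorem.** The following assertions are equivalent. (i) (DE) is well-posed. (ii) $(\mathcal A,D(\mathcal A))$ is the generator of a strongly continuous semigroup on $\mathcal E$. -/

import Mathlib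

open MeasureTheory Set Filter Topology
open scoped ContDiff

namespace DelayEq

/-! ### Strongly continuous semigroups and their generators -/

/-- `T` (restricted to `[0, ∞)`) is a strongly continuous semigroup of bounded operators on `E`. -/
structure IsC0Semigroup {𝕜 E : Type*} [RCLike 𝕜] [NormedAddCommGroup E] [NormedSpace 𝕜 E]
    (T : ℝ → E →L[𝕜] E) : Prop where
  zero : T 0 = ContinuousLinearMap.id 𝕜 E
  add : ∀ s t : ℝ, 0 ≤ s → 0 ≤ t → T (s + t) = (T s).comp (T t)
  strongly_continuous : ∀ z : E, ContinuousOn (fun t => T t z) (Ici 0)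

/-- `B` is the (infinitesimal) generator of `T`: `z ∈ D(B)` and `B z = y` if and only if
`(T h z - z) / h → y` as `h ↓ 0`. -/
def IsGeneratorOf {𝕜 E : Type*} [RCLike 𝕜] [NormedAddCommGroup E] [NormedSpace ℝ E]
    [NormedSpace 𝕜 E] (B : E →ₗ.[𝕜] E) (T : ℝ → E →L[𝕜] E) : Prop :=
  ∀ z y : E, (z, y) ∈ B.graph ↔ Tendsto (fun h : ℝ => h⁻¹ • (T h z - z)) (𝓝[>] 0) (𝓝 y)

/-- `B` (with its domain) is the generator of some strongly continuous semigroup on `E`. -/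
def GeneratesC0Semigroup {𝕜 E : Type*} [RCLike 𝕜] [NormedAddCommGroup E] [NormedSpace ℝ E]
    [NormedSpace 𝕜 E] (B : E →ₗ.[𝕜] E) : Prop :=
  ∃ T : ℝ → E →L[𝕜] E, IsC0Semigroup T ∧ IsGeneratorOf B T

/-! ### The spaces `L^p([-1,0], X)` and `W^{1,p}([-1,0], X)` -/

/-- Lebesgue measure on `[-1, 0]`. -/
noncomputable abbrev histMeasure : Measure ℝ := volume.restrict (Icc (-1) 0)

/-- The space `L^p([-1,0], X)`. -/
noncomputable abbrev HistLp (X : Type*) [NormedAddCommGroup X] (p : ENNReal) : Type _ :=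
  Lp X p histMeasure

/-- `g` is a weak derivative of `f` on `(-1, 0)`. -/
def HasWeakDeriv {X : Type*} [NormedAddCommGroup X] [NormedSpace ℝ X] (f g : ℝ → X) : Prop :=
  ∀ φ : ℝ → ℝ, ContDiff ℝ ∞ φ → HasCompactSupport φ → tsupport φ ⊆ Ioo (-1) 0 →
    ∫ σ, deriv φ σ • f σ ∂histMeasure = - ∫ σ, φ σ • g σ ∂histMeasure

section Spaces

variable (𝕜 : Type*) [RCLike 𝕜] (X : Type*) [NormedAddCommGroup X] [NormedSpace ℝ X]
  [NormedSpace 𝕜 X] [IsScalarTower ℝ 𝕜 X] (p : ENNReal) [Fact (1 ≤ p)]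

theorem integrable_smul_histLp (φ : ℝ → ℝ) (hφ : Continuous φ) (f : HistLp X p) :
    Integrable (fun σ => φ σ • f σ) histMeasure := by
  have hf : Integrable f histMeasure := (Lp.memLp f).integrable Fact.out
  exact (IntegrableOn.continuousOn_smul (K := Icc (-1 : ℝ) 0) hf hφ.continuousOn isCompact_Icc)

/-- The Sobolev space `W^{1,p}([-1,0], X)`. Its elements are the pairs `(f, f')` in
`L^p × L^p` where `f'` is the weak derivative of `f`; as a subspace of `L^p × L^p` it carries
the norm `max ‖f‖_p ‖f'‖_p`, which is equivalent to the other usual norms of `W^{1,p}`. -/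
noncomputable def sobolev : Submodule 𝕜 (HistLp X p × HistLp X p) where
  carrier := {w | HasWeakDeriv w.1 w.2}
  zero_mem' := by
    intro φ _ _ _
    have h0 : ((0 : HistLp X p) : ℝ → X) =ᵐ[histMeasure] 0 := Lp.coeFn_zero X p histMeasure
    have h1 : ∀ ψ : ℝ → ℝ, ∫ σ, ψ σ • (0 : HistLp X p) σ ∂histMeasure = 0 := by
      intro ψ
      rw [integral_congr_ae (g := fun _ => (0 : X))]
      · simp
      · filter_upwards [h0] with σ hσ
        rw [hσ]; simp
    have h2 := h1 (deriv φ)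
    have h3 := h1 φ
    change ∫ σ, deriv φ σ • (0 : HistLp X p) σ ∂histMeasure
      = - ∫ σ, φ σ • (0 : HistLp X p) σ ∂histMeasure
    rw [h2, h3, neg_zero]
  add_mem' := by
    intro v w hv hw φ hφ hc hs
    have key : ∀ ψ : ℝ → ℝ, Continuous ψ → ∀ f g : HistLp X p,
        ∫ σ, ψ σ • (f + g : HistLp X p) σ ∂histMeasure
          = ∫ σ, ψ σ • f σ ∂histMeasure + ∫ σ, ψ σ • g σ ∂histMeasure := by
      intro ψ hψ f g
      rw [← integral_add (integrable_smul_histLp X p ψ hψ f) (integrable_smul_histLp X p ψ hψ g)]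
      refine integral_congr_ae ?_
      filter_upwards [Lp.coeFn_add f g] with σ hσ
      rw [hσ, Pi.add_apply, smul_add]
    have e1 := key (deriv φ) (hφ.continuous_deriv (by simp)) v.1 w.1
    have e2 := key φ hφ.continuous v.2 w.2
    have e3 := hv φ hφ hc hs
    have e4 := hw φ hφ hc hs
    change ∫ σ, deriv φ σ • (v.1 + w.1 : HistLp X p) σ ∂histMeasure
      = - ∫ σ, φ σ • (v.2 + w.2 : HistLp X p) σ ∂histMeasure
    rw [e1, e2, e3, e4, neg_add]
  smul_mem' := by
    intro c w hw φ hφ hc hs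
    have key : ∀ ψ : ℝ → ℝ, ∀ f : HistLp X p,
        ∫ σ, ψ σ • (c • f : HistLp X p) σ ∂histMeasure
          = c • ∫ σ, ψ σ • f σ ∂histMeasure := by
      intro ψ f
      rw [← integral_smul]
      refine integral_congr_ae ?_
      filter_upwards [Lp.coeFn_smul c f] with σ hσ
      rw [hσ, Pi.smul_apply, smul_comm]
    have e3 := hw φ hφ hc hs
    change ∫ σ, deriv φ σ • (c • w.1 : HistLp X p) σ ∂histMeasure
      = - ∫ σ, φ σ • (c • w.2 : HistLp X p) σ ∂histMeasure
    rw [key, key, e3, smul_neg]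

variable {𝕜 X p}

/-- The element `f` of `L^p` underlying an element of `W^{1,p}`. -/
noncomputable def sobolevToLp : sobolev 𝕜 X p →ₗ[𝕜] HistLp X p :=
  (LinearMap.fst 𝕜 (HistLp X p) (HistLp X p)).comp (sobolev 𝕜 X p).subtype

/-- The weak derivative `d/dσ : W^{1,p} → L^p`. -/
noncomputable def sobolevDeriv : sobolev 𝕜 X p →ₗ[𝕜] HistLp X p :=
  (LinearMap.snd 𝕜 (HistLp X p) (HistLp X p)).comp (sobolev 𝕜 X p).subtype

/-- Weak derivatives are unique, so `W^{1,p}` is a space of elements of `L^p`. -/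
theorem sobolevToLp_injective [CompleteSpace X] :
    Function.Injective (sobolevToLp : sobolev 𝕜 X p →ₗ[𝕜] HistLp X p) := by
  rw [← LinearMap.ker_eq_bot, LinearMap.ker_eq_bot']
  rintro ⟨⟨f, g⟩, hfg⟩ hf
  have hf' : f = 0 := hf
  subst hf'
  have hg : g = 0 := by
    rw [Lp.eq_zero_iff_ae_eq_zero]
    have hint : Integrable g histMeasure := (Lp.memLp g).integrable Fact.out
    have hloc : LocallyIntegrableOn g (Ioo (-1 : ℝ) 0) histMeasure :=
      hint.locallyIntegrable.locallyIntegrableOn _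
    have h := isOpen_Ioo.ae_eq_zero_of_integral_contDiff_smul_eq_zero hloc (by
      intro φ hφ hc hs
      have e : ∫ σ, deriv φ σ • (0 : HistLp X p) σ ∂histMeasure
          = - ∫ σ, φ σ • g σ ∂histMeasure := hfg φ hφ hc hs
      have e0 : ∫ σ, deriv φ σ • (0 : HistLp X p) σ ∂histMeasure = 0 := by
        rw [integral_congr_ae (g := fun _ => (0 : X))]
        · simp
        · filter_upwards [Lp.coeFn_zero X p histMeasure] with σ hσ
          rw [hσ]; simp
      rw [e0] at e
      exact neg_eq_zero.mp e.symm)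
    have hmem : ∀ᵐ σ ∂histMeasure, σ ∈ Ioo (-1 : ℝ) 0 := by
      rw [histMeasure, ← Measure.restrict_congr_set (Ioo_ae_eq_Icc (μ := volume) (a := (-1 : ℝ)))]
      exact ae_restrict_mem measurableSet_Ioo
    filter_upwards [h, hmem] with σ h1 h2
    exact h1 h2
  subst hg
  rfl

/-- `x` is the value at `0` of `f`, that is, of its continuous representative on `[-1, 0]`. -/
def HasValueAtZero (f : ℝ → X) (x : X) : Prop :=
  ∃ F : ℝ → X, ContinuousOn F (Icc (-1) 0) ∧ F =ᵐ[histMeasure] f ∧ F 0 = x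

/-! ### The operator matrix -/

/-- The domain `{(x, f) ∈ D(A) × W^{1,p}([-1,0], X) : f(0) = x}`. -/
noncomputable def delayDomain (A : X →ₗ.[𝕜] X) : Submodule 𝕜 (X × HistLp X p) where
  carrier := {z | z.1 ∈ A.domain ∧
    z.2 ∈ LinearMap.range (sobolevToLp : sobolev 𝕜 X p →ₗ[𝕜] HistLp X p) ∧
    HasValueAtZero z.2 z.1}
  zero_mem' := ⟨zero_mem _, zero_mem _, fun _ => 0, continuousOn_const,
    (Lp.coeFn_zero X p histMeasure).symm, rfl⟩
  add_mem' := by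
    rintro v w ⟨h1, h2, F, hF, hF1, hF2⟩ ⟨k1, k2, G, hG, hG1, hG2⟩
    refine ⟨add_mem h1 k1, add_mem h2 k2, fun σ => F σ + G σ, hF.add hG, ?_, ?_⟩
    · exact (hF1.add hG1).trans (Lp.coeFn_add v.2 w.2).symm
    · simp [hF2, hG2]
  smul_mem' := by
    rintro c w ⟨h1, h2, F, hF, hF1, hF2⟩
    refine ⟨Submodule.smul_mem _ c h1, Submodule.smul_mem _ c h2, fun σ => c • F σ,
      hF.const_smul c, ?_, ?_⟩
    · exact (hF1.const_smul c).trans (Lp.coeFn_smul c w.2).symm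
    · simp [hF2]

/-- The second component of an element of `delayDomain A`, as an element of `W^{1,p}`. -/
noncomputable def delayDomainToSobolev [CompleteSpace X] (A : X →ₗ.[𝕜] X) :
    delayDomain (p := p) A →ₗ[𝕜] sobolev 𝕜 X p :=
  (LinearEquiv.ofInjective sobolevToLp sobolevToLp_injective).symm.toLinearMap.comp
    (((LinearMap.snd 𝕜 X (HistLp X p)).comp (delayDomain (p := p) A).subtype).codRestrict
      (LinearMap.range sobolevToLp) (fun z => z.2.2.1))

/-- The operator matrix `[[A, Φ], [0, d/dσ]]` on `X × L^p([-1,0], X)` with domain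
`delayDomain A`. -/
noncomputable def delayOperator [CompleteSpace X] (A : X →ₗ.[𝕜] X)
    (Φ : sobolev 𝕜 X p →L[𝕜] X) : (X × HistLp X p) →ₗ.[𝕜] (X × HistLp X p) where
  domain := delayDomain A
  toFun :=
    LinearMap.prod
      (A.toFun.comp
          (((LinearMap.fst 𝕜 X (HistLp X p)).comp (delayDomain (p := p) A).subtype).codRestrict
            A.domain (fun z => z.2.1))
        + Φ.toLinearMap.comp (delayDomainToSobolev A))
      (sobolevDeriv.comp (delayDomainToSobolev A))

/-! ### The delay equation -/

/-- `u` (restricted to `[-1, ∞)`) is a classical solution of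
`u'(t) = A u(t) + Φ u_t` for `t ≥ 0`, `u(0) = x`, `u_0 = f`, where `u_t(σ) = u(t + σ)` for
`σ ∈ [-1, 0]`. In `equation`, `a` is `u(t)` as an element of `D(A)` and `w` is `u_t` as an
element of `W^{1,p}`; the derivative at `t = 0` is the right derivative. -/
structure IsClassicalSolution (A : X →ₗ.[𝕜] X) (Φ : sobolev 𝕜 X p →L[𝕜] X)
    (z : X × HistLp X p) (u : ℝ → X) : Prop where
  continuousOn : ContinuousOn u (Ici (-1))
  contDiffOn : ContDiffOn ℝ 1 u (Ici 0)
  equation : ∀ t : ℝ, 0 ≤ t → ∃ (a : A.domain) (w : sobolev 𝕜 X p),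
    (a : X) = u t ∧ (sobolevToLp w =ᵐ[histMeasure] fun σ => u (t + σ)) ∧
    HasDerivWithinAt u (A a + Φ w) (Ici 0) t
  initial_value : u 0 = z.1
  initial_history : u =ᵐ[histMeasure] z.2

/-- Well-posedness of the delay equation: existence and uniqueness (on `[-1, ∞)`) of classical
solutions for all data in the domain of the operator matrix, and continuous dependence on the
data (in the norm of `X × L^p`), uniformly for `t` in compact subintervals of `[0, ∞)`. -/
structure WellPosed (A : X →ₗ.[𝕜] X) (Φ : sobolev 𝕜 X p →L[𝕜] X) : Prop where
  existence : ∀ z ∈ delayDomain (p := p) A, ∃ u, IsClassicalSolution A Φ z u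
  uniqueness : ∀ z ∈ delayDomain (p := p) A, ∀ u v, IsClassicalSolution A Φ z u →
    IsClassicalSolution A Φ z v → EqOn u v (Ici (-1))
  continuous_dependence : ∀ (zs : ℕ → X × HistLp X p) (z : X × HistLp X p)
    (us : ℕ → ℝ → X) (u : ℝ → X), (∀ n, zs n ∈ delayDomain A) → z ∈ delayDomain A →
    Tendsto zs atTop (𝓝 z) → (∀ n, IsClassicalSolution A Φ (zs n) (us n)) →
    IsClassicalSolution A Φ z u →
    ∀ a b : ℝ, 0 ≤ a → TendstoUniformlyOn us u atTop (Icc a b)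

end Spaces

end DelayEq

/-!
The proof identifies classical solutions of the delay equation with continuously differentiable
solutions of the abstract Cauchy problem `U' = 𝒜 U` for the operator matrix `𝒜`, and then uses that
`𝒜` is closed and densely defined.

If `u` is a classical solution, then `U t = (u t, u_t)` solves the abstract problem
(`IsClassicalSolution.isStrictSolution`). On `[-1, T]` the function `u` is a primitive of an `L^p`
function `v`, namely of the weak derivative of the initial history followed by the classical
derivative, and the increments of `u_t` are integrals in `L^p` of the continuous curve `v_t`, so
`u_t` has derivative `v_t`; continuity of `v_t` is continuity of translations in `L^p`, which needs
`p < ∞`. Conversely, the second component of a solution `U = (x, F)` satisfies the transport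
equation `F' = dF/dσ` with boundary value `F(t)(0) = x(t)`; testing it along characteristics shows
that `F(t)` is the history segment at time `t` of the function composed of `F(0)` and `x`
(`eq_histSegment_of_transport`, `IsStrictSolution.exists_isClassicalSolution`).

If `𝒜` generates a semigroup, the solutions of the abstract problem are exactly the orbits of
points of `D(𝒜)`, which gives existence, uniqueness and continuous dependence. If the delay equation
is well-posed, continuous dependence yields by scaling a bound on the solution operators that is
uniform on compact time intervals; they extend by density (`dense_delayDomain`) to a strongly
continuous semigroup. Its generator extends `𝒜`, and is not larger: since `𝒜` is closed
(`isClosed_delayOperator`), time averages of arbitrary orbits lie in `D(𝒜)`, and `𝒜` maps them to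
difference quotients; letting the length of the averaging interval tend to `0` puts every point of
the domain of the generator in `D(𝒜)` (`generatesC0Semigroup_of_isStrictSolution`).
-/

namespace DelayEq

/-! ### The abstract Cauchy problem and strongly continuous semigroups -/

section AbstractCauchyProblem

/-- A continuous function on `[0, ∞)` has a primitive: its integral from `0`. -/
theorem hasDerivWithinAt_integral_of_continuousOn {E : Type*} [NormedAddCommGroup E]
    [NormedSpace ℝ E] [CompleteSpace E] {V : ℝ → E} (hV : ContinuousOn V (Ici 0)) {t : ℝ}
    (ht : 0 ≤ t) : HasDerivWithinAt (fun s => ∫ r in (0 : ℝ)..s, V r) (V t) (Ici 0) t := by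
  have hc : Continuous (fun s => V (max s 0)) :=
    hV.comp_continuous (by fun_prop) (fun s => mem_Ici.2 (le_max_right _ _))
  have h := (hc.integral_hasStrictDerivAt 0 t).hasDerivAt.hasDerivWithinAt (s := Ici 0)
  rw [max_eq_left ht] at h
  have key : ∀ s ∈ Ici (0 : ℝ), (∫ r in (0 : ℝ)..s, V r) = ∫ r in (0 : ℝ)..s, V (max r 0) := by
    intro s hs
    refine intervalIntegral.integral_congr fun r hr => ?_
    rw [uIcc_of_le hs] at hr
    simp [max_eq_left hr.1]
  exact h.congr key (key t ht)

theorem integral_eq_sub_of_hasDerivWithinAt_Ici {E : Type*} [NormedAddCommGroup E]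
    [NormedSpace ℝ E] [CompleteSpace E] {U V : ℝ → E} (hV : ContinuousOn V (Ici 0))
    (hU : ∀ t, 0 ≤ t → HasDerivWithinAt U (V t) (Ici 0) t) {a b : ℝ} (ha : 0 ≤ a) (hab : a ≤ b) :
    ∫ s in a..b, V s = U b - U a := by
  refine intervalIntegral.integral_eq_sub_of_hasDeriv_right_of_le hab ?_ ?_ ?_
  · intro s hs
    exact (hU s (ha.trans hs.1)).continuousWithinAt.mono fun r hr => ha.trans hr.1
  · intro s hs
    exact (hU s (ha.trans hs.1.le)).mono fun r hr => (ha.trans hs.1.le).trans (le_of_lt hr)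
  · refine (hV.mono ?_).intervalIntegrable
    rw [uIcc_of_le hab]
    exact fun r hr => ha.trans hr.1

variable {𝕜 E : Type*} [RCLike 𝕜] [NormedAddCommGroup E] [NormedSpace 𝕜 E]

namespace IsC0Semigroup

variable {T : ℝ → E →L[𝕜] E}

theorem exists_norm_le [CompleteSpace E] (hT : IsC0Semigroup T) (b : ℝ) :
    ∃ M, 0 ≤ M ∧ ∀ t ∈ Icc 0 b, ‖T t‖ ≤ M := by
  obtain ⟨C, hC⟩ := banach_steinhaus (g := fun t : Icc (0 : ℝ) b => T t) (by
    intro z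
    obtain ⟨C, hC⟩ := isCompact_Icc.exists_bound_of_continuousOn
      ((hT.strongly_continuous z).mono (fun t (ht : t ∈ Icc 0 b) => ht.1))
    exact ⟨C, fun t => hC t t.2⟩)
  exact ⟨max C 0, le_max_right _ _, fun t ht => (hC ⟨t, ht⟩).trans (le_max_left _ _)⟩

/-- Joint continuity of `(t, z) ↦ T t z`, by local boundedness of `T`. -/
theorem tendsto_apply [CompleteSpace E] (hT : IsC0Semigroup T) {ι : Type*} {l : Filter ι}
    {τ : ι → ℝ} {y : ι → E} {τ₀ : ℝ} {y₀ : E} (hτ : Tendsto τ l (𝓝 τ₀)) (h0 : ∀ᶠ i in l, 0 ≤ τ i)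
    (hτ₀ : 0 ≤ τ₀) (hy : Tendsto y l (𝓝 y₀)) :
    Tendsto (fun i => T (τ i) (y i)) l (𝓝 (T τ₀ y₀)) := by
  obtain ⟨M, hM0, hM⟩ := hT.exists_norm_le (τ₀ + 1)
  have h1 : Tendsto (fun i => T (τ i) y₀) l (𝓝 (T τ₀ y₀)) :=
    (hT.strongly_continuous y₀ τ₀ hτ₀).tendsto.comp (tendsto_nhdsWithin_iff.2 ⟨hτ, h0⟩)
  have h2 : Tendsto (fun i => T (τ i) (y i - y₀)) l (𝓝 0) := by
    have h3 : Tendsto (fun i => M * ‖y i - y₀‖) l (𝓝 0) := by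
      simpa using ((tendsto_iff_norm_sub_tendsto_zero.1 hy).const_mul M)
    refine squeeze_zero_norm' ?_ h3
    filter_upwards [h0, hτ.eventually (eventually_le_nhds (lt_add_one τ₀))] with i hi hi'
    exact (T (τ i)).le_of_opNorm_le (hM _ ⟨hi, hi'⟩) _
  simpa using h2.add h1

end IsC0Semigroup

variable [NormedSpace ℝ E]

/-- `U` is a continuously differentiable solution on `[0, ∞)` of the abstract Cauchy problem
`U' = B U`, `U 0 = z`, and `V` is its derivative. -/
structure IsStrictSolution (B : E →ₗ.[𝕜] E) (z : E) (U V : ℝ → E) : Prop where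
  initial : U 0 = z
  mem_graph : ∀ t : ℝ, 0 ≤ t → (U t, V t) ∈ B.graph
  hasDeriv : ∀ t : ℝ, 0 ≤ t → HasDerivWithinAt U (V t) (Ici 0) t
  continuousOn_deriv : ContinuousOn V (Ici 0)

namespace IsStrictSolution

variable {B : E →ₗ.[𝕜] E} {z z' : E} {U V U' V' : ℝ → E}

theorem continuousOn (h : IsStrictSolution B z U V) : ContinuousOn U (Ici 0) :=
  fun t ht => (h.hasDeriv t ht).continuousWithinAt

theorem mem_domain (h : IsStrictSolution B z U V) {t : ℝ} (ht : 0 ≤ t) : U t ∈ B.domain :=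
  LinearPMap.mem_domain_of_mem_graph (h.mem_graph t ht)

theorem add (h : IsStrictSolution B z U V) (h' : IsStrictSolution B z' U' V') :
    IsStrictSolution B (z + z') (fun t => U t + U' t) (fun t => V t + V' t) where
  initial := by simp only [h.initial, h'.initial]
  mem_graph t ht := add_mem (h.mem_graph t ht) (h'.mem_graph t ht)
  hasDeriv t ht := (h.hasDeriv t ht).add (h'.hasDeriv t ht)
  continuousOn_deriv := h.continuousOn_deriv.add h'.continuousOn_deriv

theorem const_smul [IsScalarTower ℝ 𝕜 E] (c : 𝕜) (h : IsStrictSolution B z U V) :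
    IsStrictSolution B (c • z) (fun t => c • U t) (fun t => c • V t) where
  initial := by simp only [h.initial]
  mem_graph t ht := Submodule.smul_mem _ c (h.mem_graph t ht)
  hasDeriv t ht := (h.hasDeriv t ht).const_smul c
  continuousOn_deriv := h.continuousOn_deriv.const_smul c

theorem shift (h : IsStrictSolution B z U V) {s : ℝ} (hs : 0 ≤ s) :
    IsStrictSolution B (U s) (fun t => U (t + s)) (fun t => V (t + s)) where
  initial := by simp
  mem_graph t ht := h.mem_graph _ (add_nonneg ht hs)
  hasDeriv t ht := by
    have h1 := h.hasDeriv (t + s) (add_nonneg ht hs)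
    have h2 : HasDerivWithinAt (fun r : ℝ => r + s) 1 (Ici 0) t :=
      ((hasDerivAt_id t).add_const s).hasDerivWithinAt
    simpa using! h1.scomp t h2 (fun r hr => add_nonneg hr hs)
  continuousOn_deriv := h.continuousOn_deriv.comp (by fun_prop) (fun r hr => add_nonneg hr hs)

end IsStrictSolution

namespace IsC0Semigroup

variable {T : ℝ → E →L[𝕜] E}

/-- Orbits starting in the domain of the generator are continuously differentiable solutions of
the abstract Cauchy problem. -/
theorem isStrictSolution_orbit [CompleteSpace E] [IsScalarTower ℝ 𝕜 E] {B : E →ₗ.[𝕜] E}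
    (hT : IsC0Semigroup T) (hB : IsGeneratorOf B T) {z y : E} (hz : (z, y) ∈ B.graph) :
    IsStrictSolution B z (fun t => T t z) (fun t => T t y) := by
  have hq := (hB z y).1 hz
  have hsmul : ∀ (t c : ℝ) (x : E), T t (c • x) = c • T t x := fun t c x =>
    (T t).map_smul_of_tower c x
  refine ⟨by simp [hT.zero], fun t ht => ?_, fun t ht => ?_, hT.strongly_continuous y⟩
  · rw [hB]
    refine (((T t).continuous.tendsto y).comp hq).congr' ?_
    filter_upwards [self_mem_nhdsWithin] with h hh
    have e : T h (T t z) = T t (T h z) := by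
      rw [← ContinuousLinearMap.comp_apply, ← ContinuousLinearMap.comp_apply,
        ← hT.add h t (le_of_lt hh) ht, ← hT.add t h ht (le_of_lt hh), add_comm]
    simp only [Function.comp, hsmul, map_sub, e]
  · rw [hasDerivWithinAt_iff_tendsto_slope]
    -- both one-sided difference quotients are `T (min s t)` applied to one at `0`
    have h1 : Tendsto (fun s : ℝ => |s - t|) (𝓝[Ici 0 \ {t}] t) (𝓝[>] 0) := by
      refine tendsto_nhdsWithin_iff.2 ⟨?_, ?_⟩
      · have : Tendsto (fun s : ℝ => |s - t|) (𝓝 t) (𝓝 |t - t|) :=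
          Continuous.tendsto (by fun_prop) t
        simpa using this.mono_left nhdsWithin_le_nhds
      · filter_upwards [self_mem_nhdsWithin] with s hs
        exact abs_pos.2 (sub_ne_zero.2 hs.2)
    have h2 : Tendsto (fun s : ℝ => min s t) (𝓝[Ici 0 \ {t}] t) (𝓝 t) := by
      have : Tendsto (fun s : ℝ => min s t) (𝓝 t) (𝓝 (min t t)) :=
        Continuous.tendsto (by fun_prop) t
      simpa using this.mono_left nhdsWithin_le_nhds
    refine (hT.tendsto_apply h2 ?_ ht (hq.comp h1)).congr' ?_
    · filter_upwards [self_mem_nhdsWithin] with s hs using le_min hs.1 ht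
    · filter_upwards [self_mem_nhdsWithin] with s hs
      have hs0 : 0 ≤ s := hs.1
      rcases lt_or_gt_of_ne (show s ≠ t from hs.2) with hst | hst
      · have e : T t z = T s (T (t - s) z) := by
          rw [← ContinuousLinearMap.comp_apply, ← hT.add s (t - s) hs0 (by linarith)]
          simp
        simp only [Function.comp, slope_def_module, min_eq_left hst.le,
          abs_of_neg (sub_neg.2 hst), hsmul, map_sub, e, neg_sub]
        rw [← neg_sub t s, inv_neg, neg_smul, ← smul_neg, neg_sub]
      · have e : T s z = T t (T (s - t) z) := by
          rw [← ContinuousLinearMap.comp_apply, ← hT.add t (s - t) ht (by linarith)]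
          simp
        simp only [Function.comp, slope_def_module, min_eq_right hst.le,
          abs_of_pos (sub_pos.2 hst), hsmul, map_sub, e]

/-- Solutions of the abstract Cauchy problem for a generator are orbits: along a solution `U` the
function `s ↦ T (t - s) (U s)` has vanishing derivative. -/
theorem eq_apply_of_isStrictSolution [CompleteSpace E] [IsScalarTower ℝ 𝕜 E] {B : E →ₗ.[𝕜] E}
    (hT : IsC0Semigroup T) (hB : IsGeneratorOf B T) {z : E} {U V : ℝ → E}
    (h : IsStrictSolution B z U V) {t : ℝ} (ht : 0 ≤ t) : U t = T t z := by
  have hsmul : ∀ (t c : ℝ) (x : E), T t (c • x) = c • T t x := fun t c x =>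
    (T t).map_smul_of_tower c x
  have hd : ∀ s ∈ Icc 0 t, HasDerivWithinAt (fun r => T (t - r) (U r)) 0 (Icc 0 t) s := by
    intro s hs
    have h1 := (hT.isStrictSolution_orbit hB (h.mem_graph s hs.1)).hasDeriv (t - s)
      (sub_nonneg.2 hs.2)
    have h2 : HasDerivWithinAt (fun r : ℝ => t - r) (-1) (Icc 0 t) s :=
      ((hasDerivAt_id s).const_sub t).hasDerivWithinAt
    have h3 : HasDerivWithinAt (fun r => T (t - r) (U s)) (-(T (t - s) (V s))) (Icc 0 t) s := by
      simpa using! h1.scomp s h2 (fun r hr => sub_nonneg.2 hr.2)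
    have h4 := (h.hasDeriv s hs.1).mono (fun r (hr : r ∈ Icc 0 t) => hr.1)
    rw [hasDerivWithinAt_iff_tendsto_slope] at h3 h4 ⊢
    have h5 : Tendsto (fun r : ℝ => t - r) (𝓝[Icc 0 t \ {s}] s) (𝓝 (t - s)) :=
      (Continuous.tendsto (by fun_prop) s).mono_left nhdsWithin_le_nhds
    have h6 := hT.tendsto_apply h5 (by
      filter_upwards [self_mem_nhdsWithin] with r hr using sub_nonneg.2 hr.1.2)
      (sub_nonneg.2 hs.2) h4
    have h7 := h6.add h3
    rw [add_neg_cancel] at h7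
    refine h7.congr fun r => ?_
    simp only [slope_def_module, hsmul, map_sub]
    rw [← smul_add]
    congr 1
    abel
  have := constant_of_has_deriv_right_zero (f := fun r => T (t - r) (U r)) (a := 0) (b := t)
    (fun s hs => (hd s hs).continuousWithinAt)
    (fun s hs => (hd s ⟨hs.1, hs.2.le⟩).mono_of_mem_nhdsWithin
      (mem_of_superset (Icc_mem_nhdsGE hs.2) (Icc_subset_Icc_left hs.1))) t ⟨ht, le_rfl⟩
  simpa [hT.zero, h.initial] using this

end IsC0Semigroup

/-- Averages of a solution of `U' = B U` lie in the domain of the closed operator `B`, and `B` maps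
them to difference quotients of `U`. -/
theorem IsStrictSolution.integral_mem_graph [CompleteSpace E] [IsScalarTower ℝ 𝕜 E]
    {B : E →ₗ.[𝕜] E} (hB : B.IsClosed) {z : E} {U V : ℝ → E} (h : IsStrictSolution B z U V)
    {t : ℝ} (ht : 0 < t) :
    (t⁻¹ • ∫ s in (0 : ℝ)..t, U s, t⁻¹ • (U t - z)) ∈ B.graph := by
  have hU : ContinuousOn U (Icc 0 t) := h.continuousOn.mono fun s hs => hs.1
  have hV : ContinuousOn V (Icc 0 t) := h.continuousOn_deriv.mono fun s hs => hs.1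
  have hU' : IntegrableOn U (Ioc 0 t) := (hU.integrableOn_Icc).mono_set Ioc_subset_Icc_self
  have hV' : IntegrableOn V (Ioc 0 t) := (hV.integrableOn_Icc).mono_set Ioc_subset_Icc_self
  have hconv : Convex ℝ (B.graph : Set (E × E)) :=
    (B.graph.restrictScalars ℝ).convex
  have h1 := hconv.set_average_mem (μ := volume) (t := Ioc 0 t) (f := fun s => (U s, V s)) hB
    (by simp [ht]) (by simp)
    (by
      filter_upwards [ae_restrict_mem measurableSet_Ioc] with s hs
      exact h.mem_graph s hs.1.le) (hU'.prodMk hV')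
  rw [setAverage_eq, integral_pair hU' hV'] at h1
  have h2 := integral_eq_sub_of_hasDerivWithinAt_Ici h.continuousOn_deriv h.hasDeriv le_rfl ht.le
  rw [h.initial, intervalIntegral.integral_of_le ht.le] at h2
  rw [intervalIntegral.integral_of_le ht.le, ← h2]
  simpa [Measure.real, ht.le] using! h1

/-- If the abstract Cauchy problem for a closed, densely defined operator `B` is well-posed, then
`B` generates a strongly continuous semigroup: the solution operators extend by density, the
domain of `B` is invariant and dense, and closedness of `B` shows that the generator of the
extension is not larger than `B`. -/
theorem generatesC0Semigroup_of_isStrictSolution [CompleteSpace E] [IsScalarTower ℝ 𝕜 E]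
    {B : E →ₗ.[𝕜] E} (hB : B.IsClosed) (hd : Dense (B.domain : Set E))
    (hex : ∀ z ∈ B.domain, ∃ U V, IsStrictSolution B z U V)
    (huniq : ∀ z U V U' V', IsStrictSolution B z U V → IsStrictSolution B z U' V' →
      EqOn U U' (Ici 0))
    (hbd : ∀ b : ℝ, ∃ M, ∀ z U V, IsStrictSolution B z U V → ∀ t ∈ Icc 0 b, ‖U t‖ ≤ M * ‖z‖) :
    GeneratesC0Semigroup B := by
  choose U V hUV using fun z : B.domain => hex z z.2
  let S : ℝ → B.domain →ₗ[𝕜] E := fun t =>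
    { toFun := fun z => U z (max t 0)
      map_add' := fun z w => huniq _ _ _ _ _ (hUV (z + w)) ((hUV z).add (hUV w))
        (mem_Ici.2 (le_max_right _ _))
      map_smul' := fun c z =>
        huniq _ _ _ _ _ (hUV (c • z)) ((hUV z).const_smul c)
          (mem_Ici.2 (le_max_right _ _)) }
  have hSbd : ∀ b : ℝ, ∃ M, 0 ≤ M ∧ ∀ t ≤ b, ∀ z, ‖S t z‖ ≤ M * ‖(z : E)‖ := by
    intro b
    obtain ⟨M, hM⟩ := hbd (max b 0)
    refine ⟨max M 0, le_max_right _ _, fun t ht z => ?_⟩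
    exact (hM _ _ _ (hUV z) (max t 0) ⟨le_max_right _ _, max_le_max_right 0 ht⟩).trans
      (by gcongr; exact le_max_left _ _)
  have hdr : DenseRange B.domain.subtype := by
    simpa [DenseRange] using hd
  have hSex : ∀ t, ∃ C, ∀ z, ‖S t z‖ ≤ C * ‖B.domain.subtype z‖ := fun t => by
    obtain ⟨M, -, hM⟩ := hSbd t
    exact ⟨M, hM t le_rfl⟩
  let T : ℝ → E →L[𝕜] E := fun t => (S t).extendOfNorm B.domain.subtype
  have hTS : ∀ t, 0 ≤ t → ∀ z : B.domain, T t z = U z t := by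
    intro t ht z
    have := LinearMap.extendOfNorm_eq hdr (hSex t) z
    simpa [T, S, max_eq_left ht] using! this
  have hTbd : ∀ b : ℝ, ∃ M, 0 ≤ M ∧ ∀ t ≤ b, ∀ z, ‖T t z‖ ≤ M * ‖z‖ := by
    intro b
    obtain ⟨M, hM0, hM⟩ := hSbd b
    exact ⟨M, hM0, fun t ht z => LinearMap.norm_extendOfNorm_apply_le hdr M (hM t ht) z⟩
  have hT : IsC0Semigroup T := by
    refine ⟨?_, fun s t hs ht => ?_, fun z => ?_⟩
    · refine ContinuousLinearMap.coeFn_injective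
        (Continuous.ext_on hd (by fun_prop) (by fun_prop) ?_)
      intro z hz
      simpa [(hUV ⟨z, hz⟩).initial] using! hTS 0 le_rfl ⟨z, hz⟩
    · refine ContinuousLinearMap.coeFn_injective
        (Continuous.ext_on hd (by fun_prop) (by fun_prop) ?_)
      intro z hz
      have h1 := (hUV ⟨z, hz⟩).shift ht
      have h2 := huniq _ _ _ _ _ h1 (hUV ⟨_, (hUV ⟨z, hz⟩).mem_domain ht⟩) hs
      have e1 := hTS (s + t) (add_nonneg hs ht) ⟨z, hz⟩
      have e2 := hTS t ht ⟨z, hz⟩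
      have e3 := hTS s hs ⟨_, (hUV ⟨z, hz⟩).mem_domain ht⟩
      simp only at e1 e2 e3 h2
      rw [ContinuousLinearMap.comp_apply, e1, e2, e3, h2]
    · intro t ht
      obtain ⟨M, hM0, hM⟩ := hTbd (t + 1)
      rw [Metric.continuousWithinAt_iff']
      intro ε hε
      obtain ⟨w, hw, hzw⟩ := Metric.mem_closure_iff.1 (hd z) (ε / (3 * (M + 1))) (by positivity)
      have hw' : ∀ s ≤ t + 1, ‖T s z - T s w‖ < ε / 3 := by
        intro s hs
        rw [← map_sub]
        refine (hM s hs _).trans_lt ?_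
        rw [dist_eq_norm] at hzw
        calc M * ‖z - w‖ ≤ (M + 1) * ‖z - w‖ := by gcongr; linarith
          _ < (M + 1) * (ε / (3 * (M + 1))) := by gcongr
          _ = ε / 3 := by field_simp
      have hc := (hUV ⟨w, hw⟩).continuousOn t ht
      rw [Metric.continuousWithinAt_iff'] at hc
      filter_upwards [hc (ε / 3) (by positivity), self_mem_nhdsWithin,
        mem_nhdsWithin_of_mem_nhds (Iic_mem_nhds (lt_add_one t))] with s hs1 hs2 hs3
      rw [← hTS s hs2 ⟨w, hw⟩, ← hTS t ht ⟨w, hw⟩, dist_eq_norm] at hs1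
      have a1 := hw' s hs3
      have a2 := hw' t (by linarith)
      rw [dist_eq_norm]
      have e : T s z - T t z = (T s z - T s w) + (T s w - T t w) - (T t z - T t w) := by abel
      rw [e]
      refine (norm_sub_le _ _).trans_lt ?_
      have := norm_add_le (T s z - T s w) (T s w - T t w)
      simp only at hs1
      linarith
  refine ⟨T, hT, fun z y => ⟨fun hz => ?_, fun hz => ?_⟩⟩
  · have hzd : z ∈ B.domain := LinearPMap.mem_domain_of_mem_graph hz
    have h1 := (hUV ⟨z, hzd⟩).hasDeriv 0 le_rfl
    have h2 := (hUV ⟨z, hzd⟩).mem_graph 0 le_rfl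
    rw [(hUV ⟨z, hzd⟩).initial] at h2
    have hy : V ⟨z, hzd⟩ 0 = y := LinearPMap.mem_graph_snd_inj _ h2 hz rfl
    rw [hy] at h1
    have h3 := (hasDerivWithinAt_iff_tendsto_slope' (s := Ioi 0) (by simp)).1
      (h1.mono Ioi_subset_Ici_self)
    refine h3.congr' ?_
    filter_upwards [self_mem_nhdsWithin] with h hh
    have e := hTS h (le_of_lt hh) ⟨z, hzd⟩
    simp only at e
    rw [slope_def_module, sub_zero, e, (hUV ⟨z, hzd⟩).initial]
  · -- averages of orbits lie in the domain of `B`, first for initial values in the domain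
    have hint : ∀ t, 0 < t → ∀ z,
        (t⁻¹ • ∫ s in (0 : ℝ)..t, T s z, t⁻¹ • (T t z - z)) ∈ B.graph := by
      intro t ht
      obtain ⟨M, hM0, hM⟩ := hTbd t
      have hii : ∀ w, IntervalIntegrable (fun s => T s w) volume 0 t := fun w => by
        refine ((hT.strongly_continuous w).mono ?_).intervalIntegrable
        rw [uIcc_of_le ht.le]
        exact fun s hs => hs.1
      have hcont : Continuous fun w => ∫ s in (0 : ℝ)..t, T s w := by
        refine (LipschitzWith.of_dist_le_mul (K := (M * t).toNNReal) fun w w' => ?_).continuous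
        rw [dist_eq_norm, ← intervalIntegral.integral_sub (hii w) (hii w'), dist_eq_norm]
        refine (intervalIntegral.norm_integral_le_of_norm_le_const
          (C := M * ‖w - w'‖) fun s hs => ?_).trans ?_
        · rw [uIoc_of_le ht.le] at hs
          rw [← map_sub]
          exact hM s hs.2 _
        · rw [sub_zero, abs_of_pos ht, Real.coe_toNNReal _ (by positivity)]
          apply le_of_eq; ring
      refine fun z => isClosed_property (p := fun z => (t⁻¹ • ∫ s in (0 : ℝ)..t, T s z,
        t⁻¹ • (T t z - z)) ∈ B.graph) hdr (hB.preimage ?_) ?_ z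
      · exact (hcont.const_smul _).prodMk (((T t).continuous.sub continuous_id).const_smul _)
      · intro w
        have h1 := (hUV w).integral_mem_graph hB ht
        have e : ∫ s in (0 : ℝ)..t, T s w = ∫ s in (0 : ℝ)..t, U w s := by
          refine intervalIntegral.integral_congr fun s hs => ?_
          rw [uIcc_of_le ht.le] at hs
          exact hTS s hs.1 w
        rw [Submodule.subtype_apply, e, hTS t ht.le w]
        exact h1
    have h1 := (hasDerivWithinAt_iff_tendsto_slope' (s := Ioi 0) (by simp)).1
      ((hasDerivWithinAt_integral_of_continuousOn (hT.strongly_continuous z) le_rfl).mono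
        Ioi_subset_Ici_self)
    simp only [hT.zero, ContinuousLinearMap.id_apply] at h1
    refine IsClosed.mem_of_tendsto hB (h1.prodMk_nhds hz) ?_
    filter_upwards [self_mem_nhdsWithin] with h hh
    simpa [slope_def_module] using hint h hh z

end AbstractCauchyProblem

/-! ### Absolutely continuous representatives of Sobolev functions on `[-1, 0]` -/

section Sobolev

instance isProbabilityMeasure_histMeasure : IsProbabilityMeasure histMeasure :=
  ⟨by simp [histMeasure]⟩

variable {X : Type*} [NormedAddCommGroup X]

theorem intervalIntegrable_of_histMeasure {g : ℝ → X} (hg : Integrable g histMeasure) {a b : ℝ}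
    (ha : a ∈ Icc (-1 : ℝ) 0) (hb : b ∈ Icc (-1 : ℝ) 0) : IntervalIntegrable g volume a b := by
  have h : IntegrableOn g (Icc (-1) 0) := hg
  exact (h.mono_set (uIcc_subset_Icc ha hb)).intervalIntegrable

theorem ae_histMeasure_of_forall {P : ℝ → Prop} (h : ∀ σ ∈ Icc (-1 : ℝ) 0, P σ) :
    ∀ᵐ σ ∂histMeasure, P σ := by
  filter_upwards [ae_restrict_mem measurableSet_Icc] with σ hσ using h σ hσ

theorem ae_histMeasure_of_forall_Ioo {P : ℝ → Prop}
    (h : ∀ᵐ σ ∂histMeasure, σ ∈ Ioo (-1 : ℝ) 0 → P σ) :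
    ∀ᵐ σ ∂histMeasure, P σ := by
  have hmem : ∀ᵐ σ ∂histMeasure, σ ∈ Ioo (-1 : ℝ) 0 := by
    rw [histMeasure, ← Measure.restrict_congr_set (Ioo_ae_eq_Icc (μ := volume) (a := (-1 : ℝ)))]
    exact ae_restrict_mem measurableSet_Ioo
  filter_upwards [h, hmem] with σ h1 h2 using h1 h2

theorem eqOn_of_ae_eq_histMeasure {F G : ℝ → X} (hF : ContinuousOn F (Icc (-1) 0))
    (hG : ContinuousOn G (Icc (-1) 0)) (h : F =ᵐ[histMeasure] G) : EqOn F G (Icc (-1) 0) :=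
  Measure.eqOn_Icc_of_ae_eq volume (by norm_num) h hF hG

variable [NormedSpace ℝ X]

theorem integral_histMeasure (f : ℝ → X) :
    ∫ σ, f σ ∂histMeasure = ∫ σ in (-1 : ℝ)..0, f σ := by
  rw [intervalIntegral.integral_of_le (by norm_num), integral_Icc_eq_integral_Ioc]

theorem integrable_smul_histMeasure {φ : ℝ → ℝ} (hφ : Continuous φ) {g : ℝ → X}
    (hg : Integrable g histMeasure) : Integrable (fun σ => φ σ • g σ) histMeasure :=
  IntegrableOn.continuousOn_smul (K := Icc (-1 : ℝ) 0) hg hφ.continuousOn isCompact_Icc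

theorem continuousOn_primitive_histMeasure {g : ℝ → X} (hg : Integrable g histMeasure) :
    ContinuousOn (fun σ => ∫ s in (0 : ℝ)..σ, g s) (Icc (-1) 0) := by
  have h := intervalIntegral.continuousOn_primitive_interval' (a := 0) (b₁ := -1) (b₂ := 0)
    (intervalIntegrable_of_histMeasure hg (by simp) (by simp)) (by simp)
  rwa [uIcc_of_le (by norm_num)] at h

/-- The fundamental lemma of the calculus of variations on `(-1, 0)`. -/
theorem ae_eq_of_integral_test_eq [CompleteSpace X] {f g : ℝ → X} (hf : Integrable f histMeasure)
    (hg : Integrable g histMeasure)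
    (h : ∀ φ : ℝ → ℝ, ContDiff ℝ ∞ φ → HasCompactSupport φ → tsupport φ ⊆ Ioo (-1) 0 →
      ∫ σ, φ σ • f σ ∂histMeasure = ∫ σ, φ σ • g σ ∂histMeasure) : f =ᵐ[histMeasure] g := by
  have h1 := isOpen_Ioo.ae_eq_zero_of_integral_contDiff_smul_eq_zero (U := Ioo (-1 : ℝ) 0)
    (f := fun σ => f σ - g σ) (μ := histMeasure)
    ((hf.sub hg).locallyIntegrable.locallyIntegrableOn _) (by
      intro φ hφ hc hs
      have e : (fun σ => φ σ • (f σ - g σ)) = fun σ => φ σ • f σ - φ σ • g σ := by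
        simp only [smul_sub]
      rw [e, integral_sub (integrable_smul_histMeasure hφ.continuous hf)
        (integrable_smul_histMeasure hφ.continuous hg), h φ hφ hc hs, sub_self])
  filter_upwards [ae_histMeasure_of_forall_Ioo h1] with σ hσ using sub_eq_zero.1 hσ

/-- Integration by parts against an absolutely continuous function, by Fubini's theorem. -/
theorem integral_smul_add_integral_deriv_smul [CompleteSpace X] {F g : ℝ → X}
    (hg : Integrable g histMeasure)
    (hF : ∀ σ ∈ Icc (-1 : ℝ) 0, F σ = F 0 + ∫ s in (0 : ℝ)..σ, g s) {φ φ' : ℝ → ℝ}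
    (hφ : ∀ s, HasDerivAt φ (φ' s) s) (hφ' : Continuous φ') :
    ∫ σ, φ σ • g σ ∂histMeasure + ∫ σ, φ' σ • F σ ∂histMeasure = φ 0 • F 0 - φ (-1) • F (-1) := by
  have hφc : Continuous φ := continuous_iff_continuousAt.2 fun s => (hφ s).continuousAt
  have hF' : ∀ σ ∈ Icc (-1 : ℝ) 0, F σ = F (-1) + ∫ s in (-1 : ℝ)..σ, g s := by
    intro σ hσ
    rw [hF σ hσ, hF (-1) (by simp), add_assoc, intervalIntegral.integral_add_adjacent_intervals
      (intervalIntegrable_of_histMeasure hg (by simp) (by simp))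
      (intervalIntegrable_of_histMeasure hg (by simp) hσ)]
  let k : ℝ → ℝ → X := fun σ s => indicator {q : ℝ × ℝ | q.2 ≤ q.1} (fun q => φ' q.1 • g q.2) (σ, s)
  have hφi : Integrable φ' histMeasure := hφ'.continuousOn.integrableOn_Icc
  have hk : Integrable (Function.uncurry k) (histMeasure.prod histMeasure) :=
    (hφi.smul_prod hg).indicator (measurableSet_le measurable_snd measurable_fst)
  have hswap := integral_integral_swap hk
  have h1 : ∀ σ ∈ Icc (-1 : ℝ) 0, ∫ s, k σ s ∂histMeasure = φ' σ • (F σ - F (-1)) := by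
    intro σ hσ
    have e : (fun s => k σ s) = indicator (Iic σ) (fun s => φ' σ • g s) := by
      ext s; simp [k, indicator]
    rw [e, integral_indicator measurableSet_Iic, Measure.restrict_restrict measurableSet_Iic,
      hF' σ hσ, add_sub_cancel_left, intervalIntegral.integral_of_le hσ.1,
      ← integral_Icc_eq_integral_Ioc, ← integral_smul]
    congr 2
    ext s
    simp only [mem_inter_iff, mem_Iic, mem_Icc]
    exact ⟨fun h => ⟨h.2.1, h.1⟩, fun h => ⟨h.2, h.1, h.2.trans hσ.2⟩⟩
  have h2 : ∀ s ∈ Icc (-1 : ℝ) 0, ∫ σ, k σ s ∂histMeasure = φ 0 • g s - φ s • g s := by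
    intro s hs
    have e : (fun σ => k σ s) = indicator (Ici s) (fun σ => φ' σ • g s) := by
      ext σ; simp [k, indicator]
    have e2 : Ici s ∩ Icc (-1 : ℝ) 0 = Icc s 0 := by
      ext σ
      simp only [mem_inter_iff, mem_Ici, mem_Icc]
      exact ⟨fun h => ⟨h.1, h.2.2⟩, fun h => ⟨h.1, hs.1.trans h.1, h.2⟩⟩
    rw [e, integral_indicator measurableSet_Ici, Measure.restrict_restrict measurableSet_Ici, e2,
      integral_smul_const, integral_Icc_eq_integral_Ioc, ← intervalIntegral.integral_of_le hs.2,
      intervalIntegral.integral_eq_sub_of_hasDerivAt (fun x _ => hφ x)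
        (hφ'.intervalIntegrable _ _), sub_smul]
  rw [integral_congr_ae (ae_histMeasure_of_forall h1),
    integral_congr_ae (ae_histMeasure_of_forall h2)] at hswap
  have hFi : Integrable F histMeasure := by
    have : ContinuousOn F (Icc (-1) 0) :=
      (continuousOn_const.add (continuousOn_primitive_histMeasure hg)).congr hF
    exact this.integrableOn_Icc
  simp only [smul_sub] at hswap
  have h3 := integral_sub (integrable_smul_histMeasure hφ' hFi)
    (integrable_smul_histMeasure hφ' (integrable_const (F (-1))))
  have h4 := integral_sub (hg.smul (φ 0)) (integrable_smul_histMeasure hφc hg)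
  rw [h3, integral_smul_const, integral_histMeasure φ',
    intervalIntegral.integral_eq_sub_of_hasDerivAt (fun x _ => hφ x)
        (hφ'.intervalIntegrable _ _)] at hswap
  simp only [Pi.smul_apply] at h4
  rw [h4, integral_smul, integral_histMeasure g] at hswap
  have h5 : ∫ s in (-1 : ℝ)..0, g s = F 0 - F (-1) := by
    rw [hF' 0 (by simp)]; abel
  rw [h5] at hswap
  have h6 := sub_eq_iff_eq_add.1 hswap
  rw [h6]
  module

theorem hasWeakDeriv_of_eq_integral [CompleteSpace X] {F f g : ℝ → X}
    (hg : Integrable g histMeasure)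
    (hF : ∀ σ ∈ Icc (-1 : ℝ) 0, F σ = F 0 + ∫ s in (0 : ℝ)..σ, g s) (hf : F =ᵐ[histMeasure] f) :
    HasWeakDeriv f g := by
  intro φ hφ hc hs
  have h := integral_smul_add_integral_deriv_smul hg hF (φ := φ) (φ' := deriv φ)
    (fun s => (hφ.differentiable (by simp)).differentiableAt.hasDerivAt)
    (hφ.continuous_deriv (by simp))
  have h0 : φ 0 = 0 := image_eq_zero_of_notMem_tsupport fun h => lt_irrefl _ (hs h).2
  have h1 : φ (-1) = 0 := image_eq_zero_of_notMem_tsupport fun h => lt_irrefl _ (hs h).1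
  rw [h0, h1, zero_smul, zero_smul, sub_zero] at h
  rw [integral_congr_ae (g := fun σ => deriv φ σ • F σ)]
  · exact eq_neg_of_add_eq_zero_right h
  · filter_upwards [hf] with σ hσ using by rw [hσ]

/-- The lemma of du Bois-Reymond: a function with vanishing weak derivative is constant. -/
theorem exists_ae_eq_const_of_integral_deriv_eq_zero [CompleteSpace X] {h : ℝ → X}
    (hh : Integrable h histMeasure)
    (h0 : ∀ φ : ℝ → ℝ, ContDiff ℝ ∞ φ → HasCompactSupport φ → tsupport φ ⊆ Ioo (-1) 0 →
      ∫ σ, deriv φ σ • h σ ∂histMeasure = 0) : ∃ c, h =ᵐ[histMeasure] fun _ => c := by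
  let η₀ : ContDiffBump (-1 / 2 : ℝ) := ⟨1 / 8, 1 / 4, by norm_num, by norm_num⟩
  let η : ℝ → ℝ := η₀.normed volume
  have hη : ContDiff ℝ ∞ η := η₀.contDiff_normed
  have hηs : tsupport η = Icc (-3 / 4) (-1 / 4) := by
    rw [η₀.tsupport_normed_eq, Real.closedBall_eq_Icc]
    norm_num [η₀]
  have hη1 : ∫ σ, η σ ∂histMeasure = 1 := by
    rw [← η₀.integral_normed (μ := volume)]
    refine setIntegral_eq_integral_of_forall_compl_eq_zero fun σ hσ => ?_
    refine image_eq_zero_of_notMem_tsupport fun h' => hσ ?_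
    have h' : σ ∈ tsupport η := h'
    rw [hηs] at h'
    exact ⟨by linarith [h'.1], by linarith [h'.2]⟩
  refine ⟨∫ σ, η σ • h σ ∂histMeasure, ae_eq_of_integral_test_eq hh (integrable_const _) ?_⟩
  intro ψ hψ hc hs
  let m : ℝ := ∫ σ, ψ σ ∂histMeasure
  let θ : ℝ → ℝ := fun σ => ψ σ - m * η σ
  have hθ : ContDiff ℝ ∞ θ := hψ.sub (contDiff_const.mul hη)
  -- `θ` has integral zero, so that its primitive is again a test function
  let φ : ℝ → ℝ := fun x => ∫ s in (-1 : ℝ)..x, θ s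
  have hφd : ∀ x, HasDerivAt φ (θ x) x := fun x =>
    (hθ.continuous.integral_hasStrictDerivAt (-1) x).hasDerivAt
  have hφd' : deriv φ = θ := funext fun x => (hφd x).deriv
  have hφ : ContDiff ℝ ∞ φ := by
    rw [contDiff_infty_iff_deriv]
    exact ⟨fun x => (hφd x).differentiableAt, hφd' ▸ hθ⟩
  let K : Set ℝ := tsupport ψ ∪ Icc (-3 / 4) (-1 / 4)
  have hK : IsCompact K := hc.isCompact.union isCompact_Icc
  have hKne : K.Nonempty := ⟨-1 / 2, Or.inr ⟨by norm_num, by norm_num⟩⟩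
  have hKs : K ⊆ Ioo (-1) 0 := union_subset hs fun x hx => ⟨by linarith [hx.1], by linarith [hx.2]⟩
  have ha := hKs (hK.sInf_mem hKne)
  have hb := hKs (hK.sSup_mem hKne)
  have hθ0 : ∀ x, x ∉ K → θ x = 0 := by
    intro x hx
    have e1 : ψ x = 0 := image_eq_zero_of_notMem_tsupport fun h' => hx (Or.inl h')
    have e2 : η x = 0 := image_eq_zero_of_notMem_tsupport fun h' => hx (Or.inr (hηs ▸ h'))
    simp [θ, e1, e2]
  have hθl : ∀ x, x < sInf K → θ x = 0 := fun x hx =>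
    hθ0 x fun h' => not_lt.2 (csInf_le hK.bddBelow h') hx
  have hθr : ∀ x, sSup K < x → θ x = 0 := fun x hx =>
    hθ0 x fun h' => not_lt.2 (le_csSup hK.bddAbove h') hx
  have hθint : ∫ s in (-1 : ℝ)..0, θ s = 0 := by
    rw [← integral_histMeasure, integral_sub, integral_const_mul, hη1, mul_one, sub_self]
    · exact hψ.continuous.continuousOn.integrableOn_Icc
    · exact (continuous_const.mul hη.continuous).continuousOn.integrableOn_Icc
  have hφs : Function.support φ ⊆ Icc (sInf K) (sSup K) := by
    intro x hx
    by_contra hx'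
    rw [mem_Icc, not_and_or, not_le, not_le] at hx'
    apply hx
    rcases hx' with hx' | hx'
    · refine intervalIntegral.integral_zero_ae (Eventually.of_forall fun s hs => hθl s ?_)
      exact hs.2.trans_lt (max_lt ha.1 hx')
    · have e : φ x = (∫ s in (-1 : ℝ)..0, θ s) + ∫ s in (0 : ℝ)..x, θ s :=
        (intervalIntegral.integral_add_adjacent_intervals
          (hθ.continuous.intervalIntegrable _ _) (hθ.continuous.intervalIntegrable _ _)).symm
      rw [e, hθint, zero_add]
      refine intervalIntegral.integral_zero_ae (Eventually.of_forall fun s hs => hθr s ?_)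
      exact (lt_min hb.2 hx').trans hs.1
  have hφts : tsupport φ ⊆ Icc (sInf K) (sSup K) := closure_minimal hφs isClosed_Icc
  have key := h0 φ hφ (HasCompactSupport.of_support_subset_isCompact isCompact_Icc hφs)
    (hφts.trans fun x hx => ⟨ha.1.trans_le hx.1, hx.2.trans_lt hb.2⟩)
  rw [hφd'] at key
  have e : (fun σ => θ σ • h σ) = fun σ => ψ σ • h σ - m • (η σ • h σ) := by
    ext σ; simp only [θ, sub_smul, mul_smul]
  have hm : Integrable (fun σ => m • (η σ • h σ)) histMeasure :=
    (integrable_smul_histMeasure hη.continuous hh).smul m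
  rw [e, integral_sub (integrable_smul_histMeasure hψ.continuous hh) hm, integral_smul,
    sub_eq_zero] at key
  rw [key, integral_smul_const]

/-- A function with an integrable weak derivative is almost everywhere equal to a primitive of it:
the difference of the two has vanishing weak derivative. -/
theorem HasWeakDeriv.exists_ae_eq_integral [CompleteSpace X] {f g : ℝ → X}
    (hf : Integrable f histMeasure) (hg : Integrable g histMeasure) (h : HasWeakDeriv f g) :
    ∃ c, f =ᵐ[histMeasure] fun σ => c + ∫ s in (0 : ℝ)..σ, g s := by
  let G : ℝ → X := fun σ => ∫ s in (0 : ℝ)..σ, g s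
  have hG : Integrable G histMeasure := (continuousOn_primitive_histMeasure hg).integrableOn_Icc
  have hGw : HasWeakDeriv G g :=
    hasWeakDeriv_of_eq_integral hg (F := G) (fun σ _ => by simp [G]) (ae_eq_refl _)
  obtain ⟨c, hc⟩ := exists_ae_eq_const_of_integral_deriv_eq_zero (hf.sub hG) (by
    intro φ hφ hc hs
    have hd := hφ.continuous_deriv (by simp)
    simp only [Pi.sub_apply, smul_sub]
    rw [integral_sub (integrable_smul_histMeasure hd hf) (integrable_smul_histMeasure hd hG),
      h φ hφ hc hs, hGw φ hφ hc hs, sub_self])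
  refine ⟨c, ?_⟩
  filter_upwards [hc] with σ hσ
  rw [← hσ]
  simp [G]

theorem HasWeakDeriv.eq_integral_of_continuousOn [CompleteSpace X] {F f g : ℝ → X}
    (hf : Integrable f histMeasure) (hg : Integrable g histMeasure) (h : HasWeakDeriv f g)
    (hF : ContinuousOn F (Icc (-1) 0)) (hFf : F =ᵐ[histMeasure] f) :
    ∀ σ ∈ Icc (-1 : ℝ) 0, F σ = F 0 + ∫ s in (0 : ℝ)..σ, g s := by
  obtain ⟨c, hc⟩ := h.exists_ae_eq_integral hf hg
  have e := eqOn_of_ae_eq_histMeasure hF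
    (continuousOn_const.add (continuousOn_primitive_histMeasure hg)) (hFf.trans hc)
  have e0 : F 0 = c := by simpa using e (show (0 : ℝ) ∈ Icc (-1) 0 by simp)
  intro σ hσ
  rw [e0]
  exact e hσ

end Sobolev

/-! ### The operator matrix is closed -/

section Closed

variable {X : Type*} [NormedAddCommGroup X] {p : ENNReal} [Fact (1 ≤ p)]

theorem integrable_histLp (f : HistLp X p) : Integrable f histMeasure :=
  (Lp.memLp f).integrable Fact.out

theorem integral_norm_histLp_le (f : HistLp X p) : ∫ σ, ‖f σ‖ ∂histMeasure ≤ ‖f‖ := by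
  have h1 : eLpNorm f 1 histMeasure ≤ eLpNorm f p histMeasure :=
    eLpNorm_le_eLpNorm_of_exponent_le Fact.out (Lp.aestronglyMeasurable f)
  rw [integral_norm_eq_lintegral_enorm (Lp.aestronglyMeasurable f), Lp.norm_def,
    ← eLpNorm_one_eq_lintegral_enorm]
  exact ENNReal.toReal_mono (Lp.eLpNorm_ne_top f) h1

variable {𝕜 : Type*} [RCLike 𝕜] [NormedSpace ℝ X] [NormedSpace 𝕜 X] [IsScalarTower ℝ 𝕜 X]

/-- The bilinear pairing `(φ, f) ↦ ∫ φ f` of bounded continuous scalar functions with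
`L^p([-1,0], X)`. -/
noncomputable def histPairing (X : Type*) [NormedAddCommGroup X] [NormedSpace ℝ X] (p : ENNReal)
    [Fact (1 ≤ p)] : BoundedContinuousFunction ℝ ℝ →L[ℝ] HistLp X p →L[ℝ] X :=
  LinearMap.mkContinuous₂
    (LinearMap.mk₂ ℝ (fun (φ : BoundedContinuousFunction ℝ ℝ) (f : HistLp X p) =>
        ∫ σ, φ σ • f σ ∂histMeasure)
      (fun φ ψ f => by
        simp only [BoundedContinuousFunction.add_apply, add_smul]
        exact integral_add (integrable_smul_histMeasure φ.continuous (integrable_histLp f))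
          (integrable_smul_histMeasure ψ.continuous (integrable_histLp f)))
      (fun c φ f => by
        simp only [BoundedContinuousFunction.smul_apply, smul_assoc]
        exact integral_smul c _)
      (fun φ f g => by
        rw [← integral_add (integrable_smul_histMeasure φ.continuous (integrable_histLp f))
          (integrable_smul_histMeasure φ.continuous (integrable_histLp g))]
        refine integral_congr_ae ?_
        filter_upwards [Lp.coeFn_add f g] with σ hσ
        rw [hσ, Pi.add_apply, smul_add])
      (fun c φ f => by
        rw [← integral_smul]
        refine integral_congr_ae ?_
        filter_upwards [Lp.coeFn_smul c f] with σ hσ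
        rw [hσ, Pi.smul_apply, smul_comm])) 1
    (fun φ f => by
      rw [one_mul, LinearMap.mk₂_apply]
      refine (norm_integral_le_of_norm_le ((integrable_histLp f).norm.const_mul ‖φ‖)
        (Eventually.of_forall fun σ => ?_)).trans ?_
      · rw [norm_smul]
        gcongr
        exact φ.norm_coe_le_norm σ
      · rw [integral_const_mul]
        gcongr
        exact integral_norm_histLp_le f)

/-- Weak derivatives are stable under convergence in `L^p`. -/
theorem isClosed_sobolev : IsClosed (sobolev 𝕜 X p : Set (HistLp X p × HistLp X p)) := by
  have e : (sobolev 𝕜 X p : Set (HistLp X p × HistLp X p)) =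
      ⋂ (φ : ℝ → ℝ) (hφ : ContDiff ℝ ∞ φ) (hc : HasCompactSupport φ)
        (_ : tsupport φ ⊆ Ioo (-1) 0),
        {w | histPairing X p (BoundedContinuousFunction.ofNormedAddCommGroup (deriv φ)
            (hφ.continuous_deriv (by simp)) _
            (hc.deriv.exists_bound_of_continuous (hφ.continuous_deriv (by simp))).choose_spec) w.1 =
          -histPairing X p (BoundedContinuousFunction.ofNormedAddCommGroup φ
            hφ.continuous _ (hc.exists_bound_of_continuous hφ.continuous).choose_spec) w.2} := by
    ext w
    simp only [mem_iInter, mem_ofPred_eq]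
    rfl
  rw [e]
  refine isClosed_iInter fun φ => isClosed_iInter fun hφ => isClosed_iInter fun hc =>
    isClosed_iInter fun _ => isClosed_eq (by fun_prop) (by fun_prop)

/-- The value at `0` of a Sobolev function is a bounded functional of the function and its
derivative: this is integration by parts against a function which is `1` at `0` and vanishes
at `-1`. -/
theorem hasValueAtZero_iff [CompleteSpace X] {f g : HistLp X p} (h : HasWeakDeriv f g) (x : X) :
    HasValueAtZero f x ↔
      x = ∫ σ, Real.cos (Real.pi / 2 * σ) • g σ ∂histMeasure +
        ∫ σ, (-(Real.pi / 2) * Real.sin (Real.pi / 2 * σ)) • f σ ∂histMeasure := by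
  have hd : ∀ s, HasDerivAt (fun σ : ℝ => Real.cos (Real.pi / 2 * σ))
      (-(Real.pi / 2) * Real.sin (Real.pi / 2 * s)) s := by
    intro s
    have h1 := (Real.hasDerivAt_cos (Real.pi / 2 * s)).comp s
      ((hasDerivAt_id s).const_mul (Real.pi / 2))
    simp only [mul_one] at h1
    convert! h1 using 1
    ring
  have key : ∀ F : ℝ → X, ContinuousOn F (Icc (-1) 0) → F =ᵐ[histMeasure] f →
      ∫ σ, Real.cos (Real.pi / 2 * σ) • g σ ∂histMeasure +
        ∫ σ, (-(Real.pi / 2) * Real.sin (Real.pi / 2 * σ)) • f σ ∂histMeasure = F 0 := by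
    intro F hF hFf
    have h1 := integral_smul_add_integral_deriv_smul (integrable_histLp g)
      (h.eq_integral_of_continuousOn (integrable_histLp f) (integrable_histLp g) hF hFf) hd
      (by fun_prop)
    rw [mul_zero, Real.cos_zero, one_smul, mul_neg_one, Real.cos_neg, Real.cos_pi_div_two,
      zero_smul, sub_zero] at h1
    rw [← h1]
    congr 1
    refine integral_congr_ae ?_
    filter_upwards [hFf] with σ hσ using by rw [hσ]
  constructor
  · rintro ⟨F, hF, hFf, rfl⟩
    exact (key F hF hFf).symm
  · intro hx
    obtain ⟨c, hc⟩ := h.exists_ae_eq_integral (integrable_histLp f) (integrable_histLp g)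
    refine ⟨_, continuousOn_const.add
      (continuousOn_primitive_histMeasure (integrable_histLp g)), hc.symm, ?_⟩
    rw [hx]
    exact (key _ (continuousOn_const.add
      (continuousOn_primitive_histMeasure (integrable_histLp g))) hc.symm).symm

theorem mem_graph_delayOperator_iff [CompleteSpace X] {A : X →ₗ.[𝕜] X}
    {Φ : sobolev 𝕜 X p →L[𝕜] X} {z y : X × HistLp X p} :
    (z, y) ∈ (delayOperator A Φ).graph ↔ ∃ (a : A.domain) (w : sobolev 𝕜 X p),
      (a : X) = z.1 ∧ sobolevToLp w = z.2 ∧ HasValueAtZero z.2 z.1 ∧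
      y = (A a + Φ w, sobolevDeriv w) := by
  have hw : ∀ z : delayDomain (p := p) A, sobolevToLp (delayDomainToSobolev A z) = z.1.2 := by
    intro z
    exact congrArg Subtype.val ((LinearEquiv.ofInjective (sobolevToLp (𝕜 := 𝕜) (X := X) (p := p))
      sobolevToLp_injective).apply_symm_apply _)
  rw [LinearPMap.mem_graph_iff]
  constructor
  · rintro ⟨d, hd, hy⟩
    simp only at hd hy
    refine ⟨⟨d.1.1, d.2.1⟩, delayDomainToSobolev A d, by rw [← hd],
      (hw d).trans (congrArg Prod.snd hd), ?_, hy.symm⟩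
    rw [← hd]
    exact d.2.2.2
  · rintro ⟨a, w, ha, hw', hv, rfl⟩
    have hd : z ∈ delayDomain (p := p) A := ⟨ha ▸ a.2, ⟨w, hw'⟩, hv⟩
    have e1 : delayDomainToSobolev A ⟨z, hd⟩ = w :=
      sobolevToLp_injective ((hw ⟨z, hd⟩).trans hw'.symm)
    have e2 : (⟨z.1, hd.1⟩ : A.domain) = a := Subtype.ext ha.symm
    refine ⟨⟨z, hd⟩, rfl, ?_⟩
    change (A ⟨z.1, hd.1⟩ + Φ (delayDomainToSobolev A ⟨z, hd⟩),
      sobolevDeriv (delayDomainToSobolev A ⟨z, hd⟩)) = _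
    rw [e1, e2]

theorem isClosed_delayOperator [CompleteSpace X] {A : X →ₗ.[𝕜] X} (hA : A.IsClosed)
    (Φ : sobolev 𝕜 X p →L[𝕜] X) : (delayOperator A Φ).IsClosed := by
  let φ : BoundedContinuousFunction ℝ ℝ := BoundedContinuousFunction.ofNormedAddCommGroup
    (fun σ => Real.cos (Real.pi / 2 * σ)) (by fun_prop) 1 (fun σ => Real.abs_cos_le_one _)
  let φ' : BoundedContinuousFunction ℝ ℝ := BoundedContinuousFunction.ofNormedAddCommGroup
    (fun σ => -(Real.pi / 2) * Real.sin (Real.pi / 2 * σ)) (by fun_prop) (Real.pi / 2)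
    (fun σ => by
      rw [norm_mul, norm_neg, Real.norm_of_nonneg (by positivity)]
      exact mul_le_of_le_one_right (by positivity) (Real.abs_sin_le_one _))
  have hv : ∀ (w : sobolev 𝕜 X p) (x : X), HasValueAtZero w.1.1 x ↔
      x = histPairing X p φ w.1.2 + histPairing X p φ' w.1.1 := fun w x =>
    hasValueAtZero_iff w.2 x
  refine IsSeqClosed.isClosed ?_
  intro q q₀ hq hlim
  choose a w ha hw h0 hy using fun n => mem_graph_delayOperator_iff.1
    (show ((q n).1, (q n).2) ∈ (delayOperator A Φ).graph from hq n)
  have hz := (continuous_fst.tendsto _).comp hlim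
  have hy' := (continuous_snd.tendsto _).comp hlim
  have hz1 := (continuous_fst.tendsto _).comp hz
  have hz2 := (continuous_snd.tendsto _).comp hz
  have hy1 := (continuous_fst.tendsto _).comp hy'
  have hy2 := (continuous_snd.tendsto _).comp hy'
  have hw1 : ∀ n, (w n : HistLp X p × HistLp X p) = ((q n).1.2, (q n).2.2) := fun n =>
    Prod.ext (hw n) (by rw [hy n]; rfl)
  have hwlim : Tendsto (fun n => (w n : HistLp X p × HistLp X p)) atTop
      (𝓝 (q₀.1.2, q₀.2.2)) := by
    simp only [hw1]
    exact hz2.prodMk_nhds hy2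
  have hmem : (q₀.1.2, q₀.2.2) ∈ sobolev 𝕜 X p :=
    isClosed_sobolev.mem_of_tendsto hwlim (Eventually.of_forall fun n => (w n).2)
  let w₀ : sobolev 𝕜 X p := ⟨(q₀.1.2, q₀.2.2), hmem⟩
  have hwlim' : Tendsto w atTop (𝓝 w₀) := tendsto_subtype_rng.2 hwlim
  have hAlim : Tendsto (fun n => ((a n : X), A (a n))) atTop (𝓝 (q₀.1.1, q₀.2.1 - Φ w₀)) := by
    refine Tendsto.prodMk_nhds ?_ ?_
    · simp only [ha]
      exact hz1
    · have e : ∀ n, A (a n) = (q n).2.1 - Φ (w n) := fun n => by rw [hy n]; simp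
      simp only [e]
      exact hy1.sub ((Φ.continuous.tendsto _).comp hwlim')
  have hAmem : (q₀.1.1, q₀.2.1 - Φ w₀) ∈ A.graph :=
    IsClosed.mem_of_tendsto hA hAlim (Eventually.of_forall fun n => A.mem_graph (a n))
  obtain ⟨a₀, ha₀, hAa₀⟩ := (LinearPMap.mem_graph_iff _).1 hAmem
  refine mem_graph_delayOperator_iff.2 ⟨a₀, w₀, ha₀, rfl, ?_, ?_⟩
  · refine (hv w₀ _).2 (tendsto_nhds_unique hz1 ?_)
    have e : ∀ n, (q n).1.1 = histPairing X p φ (q n).2.2 + histPairing X p φ' (q n).1.2 := by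
      intro n
      have h1 := h0 n
      rw [← hw n] at h1
      have h2 := (hv (w n) _).1 h1
      rwa [hw1 n] at h2
    simp only [Function.comp_def, e]
    exact (((histPairing X p φ).continuous.tendsto _).comp hy2).add
      (((histPairing X p φ').continuous.tendsto _).comp hz2)
  · refine Prod.ext ?_ rfl
    simp only at hAa₀ ⊢
    rw [hAa₀]
    abel

end Closed

/-! ### History segments and their dependence on time -/

section Segment

variable {X : Type*} [NormedAddCommGroup X] {p : ENNReal}

open Classical in
/-- The history segment `u_t`, `u_t σ = u (t + σ)`, as an element of `L^p([-1,0], X)`; it is `0`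
when `u_t` is not in `L^p`. -/
noncomputable def histSegment (p : ENNReal) (u : ℝ → X) (t : ℝ) : HistLp X p :=
  if h : MemLp (fun σ => u (t + σ)) p histMeasure then h.toLp _ else 0

theorem histSegment_coeFn {u : ℝ → X} {t : ℝ} (h : MemLp (fun σ => u (t + σ)) p histMeasure) :
    histSegment p u t =ᵐ[histMeasure] fun σ => u (t + σ) := by
  rw [histSegment, dif_pos h]
  exact h.coeFn_toLp

theorem histSegment_eq_iff {u : ℝ → X} {t : ℝ} (h : MemLp (fun σ => u (t + σ)) p histMeasure)
    {f : HistLp X p} : histSegment p u t = f ↔ f =ᵐ[histMeasure] fun σ => u (t + σ) := by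
  rw [Lp.ext_iff]
  exact ⟨fun e => e.symm.trans (histSegment_coeFn h), fun e => (histSegment_coeFn h).trans e.symm⟩

theorem histSegment_congr {u v : ℝ → X} {t : ℝ} (h : ∀ σ ∈ Icc (-1 : ℝ) 0, u (t + σ) = v (t + σ)) :
    histSegment p u t = histSegment p v t := by
  have e : (fun σ => u (t + σ)) =ᵐ[histMeasure] fun σ => v (t + σ) := ae_histMeasure_of_forall h
  by_cases hu : MemLp (fun σ => u (t + σ)) p histMeasure
  · rw [histSegment_eq_iff hu]
    exact (histSegment_coeFn (hu.ae_eq e)).trans e.symm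
  · have hv : ¬ MemLp (fun σ => v (t + σ)) p histMeasure := fun hv => hu (hv.ae_eq e.symm)
    rw [histSegment, histSegment, dif_neg hu, dif_neg hv]

theorem memLp_segment {v : ℝ → X} (hv : MemLp v p volume) (t : ℝ) :
    MemLp (fun σ => v (t + σ)) p histMeasure :=
  (hv.comp_measurePreserving (measurePreserving_add_left volume t)).restrict _

theorem memLp_restrict_of_continuousOn {w : ℝ → X} {K : Set ℝ} (hK : IsCompact K)
    (hw : ContinuousOn w K) : MemLp w p (volume.restrict K) := by
  obtain ⟨C, hC⟩ := hK.exists_bound_of_continuousOn hw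
  have : IsFiniteMeasure (volume.restrict K) := ⟨by simpa using hK.measure_lt_top⟩
  exact MemLp.of_bound (hw.aestronglyMeasurable_of_isCompact hK hK.measurableSet) C
    ((ae_restrict_mem hK.measurableSet).mono hC)

theorem memLp_segment_of_continuousOn {u : ℝ → X} (hu : ContinuousOn u (Ici (-1))) {t : ℝ}
    (ht : 0 ≤ t) : MemLp (fun σ => u (t + σ)) p histMeasure := by
  refine memLp_restrict_of_continuousOn isCompact_Icc (hu.comp (by fun_prop) ?_)
  intro σ hσ
  exact mem_Ici.2 (by linarith [hσ.1])

/-- The function which is `g` on `[-1, 0]`, `w` on `(0, T]` and `0` elsewhere. -/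
noncomputable def glue (g w : ℝ → X) (T : ℝ) : ℝ → X := fun s =>
  indicator (Icc (-1) 0) g s + indicator (Ioc 0 T) w s

theorem memLp_glue {g w : ℝ → X} {T : ℝ} (hg : MemLp g p histMeasure)
    (hw : ContinuousOn w (Icc 0 T)) : MemLp (glue g w T) p volume := by
  refine MemLp.add ?_ ?_
  · rw [memLp_indicator_iff_restrict measurableSet_Icc]
    exact hg
  · rw [memLp_indicator_iff_restrict measurableSet_Ioc]
    exact (memLp_restrict_of_continuousOn isCompact_Icc hw).mono_measure
      (Measure.restrict_mono Ioc_subset_Icc_self le_rfl)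

variable [Fact (1 ≤ p)]

/-- Translation is continuous in `L^p` for `p < ∞`. -/
theorem continuous_histSegment (hp : p ≠ ⊤) {v : ℝ → X} (hv : MemLp v p volume) :
    Continuous (histSegment p v) := by
  let g : ℝ → C(ℝ, ℝ) := fun t => ⟨fun s => t + s, by fun_prop⟩
  have hg : Continuous g :=
    (ContinuousMap.curry (⟨fun q : ℝ × ℝ => q.1 + q.2, by fun_prop⟩ : C(ℝ × ℝ, ℝ))).continuous
  have hgm : ∀ t, MeasurePreserving (g t) volume volume := fun t =>
    measurePreserving_add_left volume t
  have h1 : Continuous fun t => Lp.compMeasurePreserving (g t) (hgm t) (hv.toLp v) :=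
    continuous_const.compMeasurePreservingLp hg hgm hp
  have h2 : Continuous fun f : Lp X p (volume : Measure ℝ) =>
      ((Lp.memLp f).restrict (Icc (-1 : ℝ) 0)).toLp f := by
    refine (LipschitzWith.of_dist_le_mul (K := 1) fun f f' => ?_).continuous
    rw [NNReal.coe_one, one_mul, Lp.dist_def, Lp.dist_def]
    refine ENNReal.toReal_mono ?_ ?_
    · exact ((Lp.memLp f).sub (Lp.memLp f')).2.ne
    · refine (eLpNorm_congr_ae (((Lp.memLp f).restrict _).coeFn_toLp.sub
        ((Lp.memLp f').restrict _).coeFn_toLp)).trans_le ?_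
      exact eLpNorm_mono_measure _ Measure.restrict_le_self
  refine (h2.comp h1).congr fun t => ?_
  symm
  rw [histSegment_eq_iff (memLp_segment hv t)]
  refine ((Lp.memLp (Lp.compMeasurePreserving (g t) (hgm t) (hv.toLp v))).restrict
    (Icc (-1 : ℝ) 0)).coeFn_toLp.trans (ae_restrict_of_ae ?_)
  have h3 := Lp.coeFn_compMeasurePreserving (hv.toLp v) (hgm t)
  have h4 := (hgm t).quasiMeasurePreserving.ae_eq_comp hv.coeFn_toLp
  exact h3.trans h4

variable [NormedSpace ℝ X]

theorem integral_glue_of_nonpos (g w : ℝ → X) (T : ℝ) {t : ℝ} (ht : t ∈ Icc (-1 : ℝ) 0) :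
    ∫ s in (0 : ℝ)..t, glue g w T s = ∫ s in (0 : ℝ)..t, g s := by
  refine intervalIntegral.integral_congr fun s hs => ?_
  rw [uIcc_of_ge ht.2] at hs
  have h1 : s ∈ Icc (-1 : ℝ) 0 := ⟨ht.1.trans hs.1, hs.2⟩
  have h2 : s ∉ Ioc 0 T := fun h => not_lt.2 hs.2 h.1
  simp [glue, indicator_of_mem h1, indicator_of_notMem h2]

theorem integral_glue_of_nonneg (g w : ℝ → X) {T : ℝ} {t : ℝ} (ht : t ∈ Icc 0 T) :
    ∫ s in (0 : ℝ)..t, glue g w T s = ∫ s in (0 : ℝ)..t, w s := by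
  rw [intervalIntegral.integral_of_le ht.1, intervalIntegral.integral_of_le ht.1]
  refine setIntegral_congr_fun measurableSet_Ioc fun s hs => ?_
  have h1 : s ∉ Icc (-1 : ℝ) 0 := fun h => not_lt.2 h.2 hs.1
  have h2 : s ∈ Ioc 0 T := ⟨hs.1, hs.2.trans ht.2⟩
  simp [glue, indicator_of_mem h2, indicator_of_notMem h1]

theorem HasWeakDeriv.congr {f g f' g' : ℝ → X} (h : HasWeakDeriv f g) (hf : f =ᵐ[histMeasure] f')
    (hg : g =ᵐ[histMeasure] g') : HasWeakDeriv f' g' := by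
  intro φ hφ hc hs
  have h1 : ∫ σ, deriv φ σ • f' σ ∂histMeasure = ∫ σ, deriv φ σ • f σ ∂histMeasure :=
    integral_congr_ae (by filter_upwards [hf] with σ hσ using by rw [hσ])
  have h2 : ∫ σ, φ σ • g' σ ∂histMeasure = ∫ σ, φ σ • g σ ∂histMeasure :=
    integral_congr_ae (by filter_upwards [hg] with σ hσ using by rw [hσ])
  rw [h1, h2]
  exact h φ hφ hc hs

theorem continuous_of_eq_integral {u v : ℝ → X} (hv : Integrable v)
    (hu : ∀ t, u t = u 0 + ∫ r in (0 : ℝ)..t, v r) : Continuous u := by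
  rw [funext hu]
  exact continuous_const.add (intervalIntegral.continuous_primitive
    (fun a b => hv.intervalIntegrable) 0)

variable [CompleteSpace X]

theorem hasWeakDeriv_segment {u v : ℝ → X} (hv : Integrable v)
    (hu : ∀ t, u t = u 0 + ∫ r in (0 : ℝ)..t, v r) (t : ℝ) :
    HasWeakDeriv (fun σ => u (t + σ)) (fun σ => v (t + σ)) := by
  refine hasWeakDeriv_of_eq_integral (hv.comp_add_left t).integrableOn (fun σ _ => ?_)
    (ae_eq_refl _)
  rw [add_zero, hu (t + σ), hu t, intervalIntegral.integral_comp_add_left, add_zero, add_assoc,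
    intervalIntegral.integral_add_adjacent_intervals hv.intervalIntegrable hv.intervalIntegrable]

/-- The increment of the history segments of a primitive of `v` is the integral in `L^p` of the
history segments of `v`. Both sides have the same pairing with every test function, by Fubini's
theorem. -/
theorem histSegment_sub_histSegment (hp : p ≠ ⊤) {u v : ℝ → X} (hv : Integrable v)
    (hvp : MemLp v p volume) (hu : ∀ t, u t = u 0 + ∫ r in (0 : ℝ)..t, v r) {a b : ℝ}
    (hab : a ≤ b) :
    histSegment p u b - histSegment p u a = ∫ r in a..b, histSegment p v r := by
  have hseg : ∀ t, histSegment p u t =ᵐ[histMeasure] fun σ => u (t + σ) := fun t =>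
    histSegment_coeFn (memLp_restrict_of_continuousOn isCompact_Icc
      ((continuous_of_eq_integral hv hu).comp (continuous_const_add t)).continuousOn)
  have hsv : ∀ t, histSegment p v t =ᵐ[histMeasure] fun σ => v (t + σ) := fun t =>
    histSegment_coeFn (memLp_segment hvp t)
  rw [Lp.ext_iff]
  refine ae_eq_of_integral_test_eq (integrable_histLp _) (integrable_histLp _) ?_
  intro φ hφ hc _
  obtain ⟨C, hC⟩ := hc.exists_bound_of_continuous hφ.continuous
  let φb : BoundedContinuousFunction ℝ ℝ :=
    BoundedContinuousFunction.ofNormedAddCommGroup φ hφ.continuous C hC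
  change _ = histPairing X p φb (∫ r in a..b, histSegment p v r)
  rw [← ContinuousLinearMap.intervalIntegral_comp_comm _
    ((continuous_histSegment hp hvp).intervalIntegrable a b)]
  have e1 : ∀ r, histPairing X p φb (histSegment p v r) = ∫ σ, φ σ • v (r + σ) ∂histMeasure := by
    intro r
    refine integral_congr_ae ?_
    filter_upwards [hsv r] with σ hσ
    rw [hσ]
    rfl
  have e2 : ∫ σ, φ σ • (histSegment p u b - histSegment p u a : HistLp X p) σ ∂histMeasure =
      ∫ σ, (∫ r in a..b, φ σ • v (r + σ)) ∂histMeasure := by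
    refine integral_congr_ae ?_
    filter_upwards [Lp.coeFn_sub (histSegment p u b) (histSegment p u a), hseg b, hseg a] with
      σ h1 h2 h3
    rw [h1, Pi.sub_apply, h2, h3, intervalIntegral.integral_smul,
      intervalIntegral.integral_comp_add_right, hu (b + σ), hu (a + σ), add_sub_add_left_eq_sub,
      intervalIntegral.integral_interval_sub_left hv.intervalIntegrable hv.intervalIntegrable]
  rw [e2]
  simp only [e1]
  simp only [intervalIntegral.integral_of_le hab]
  refine integral_integral_swap ?_
  -- the integrand is the restriction of a product of integrable functions after a shear
  have h1 : Integrable (fun q : ℝ × ℝ => (indicator (Icc (-1) 0) φ q.1) • v q.2)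
      (volume.prod volume) := by
    refine Integrable.smul_prod ?_ hv
    exact hφ.continuous.continuousOn.integrableOn_Icc.integrable_indicator measurableSet_Icc
  have h2 := (measurePreserving_prod_add (volume : Measure ℝ) (volume : Measure ℝ))
    |>.integrable_comp_of_integrable h1
  rw [Measure.prod_restrict]
  refine (h2.integrableOn (s := Icc (-1) 0 ×ˢ Ioc a b)).congr_fun ?_
    (measurableSet_Icc.prod measurableSet_Ioc)
  rintro ⟨σ, r⟩ ⟨h3, -⟩
  simp [indicator_of_mem h3, add_comm]

theorem hasDerivAt_histSegment (hp : p ≠ ⊤) {u v : ℝ → X} (hv : Integrable v)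
    (hvp : MemLp v p volume) (hu : ∀ t, u t = u 0 + ∫ r in (0 : ℝ)..t, v r) (t : ℝ) :
    HasDerivAt (histSegment p u) (histSegment p v t) t := by
  have h1 := ((continuous_histSegment hp hvp).integral_hasStrictDerivAt (t - 1) t).hasDerivAt
  have h2 := h1.const_add (histSegment p u (t - 1))
  refine h2.congr_of_eventuallyEq ?_
  filter_upwards [Ici_mem_nhds (sub_one_lt t)] with s hs
  rw [← histSegment_sub_histSegment hp hv hvp hu hs]
  abel

/-- The history segments of a function which is a primitive of `v` on `[-1, T]` lie in `W^{1,p}` and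
are differentiable in `L^p`, with the history segments of `v` as weak and as time derivatives. -/
theorem hasDerivWithinAt_histSegment (hp : p ≠ ⊤) {u v : ℝ → X} (hv : Integrable v)
    (hvp : MemLp v p volume) {T : ℝ}
    (hu : ∀ t ∈ Icc (-1) T, u t = u 0 + ∫ r in (0 : ℝ)..t, v r) {t : ℝ} (ht : t ∈ Icc 0 T) :
    HasWeakDeriv (histSegment p u t) (histSegment p v t) ∧
      HasDerivWithinAt (histSegment p u) (histSegment p v t) (Icc 0 T) t := by
  let u' : ℝ → X := fun t => u 0 + ∫ r in (0 : ℝ)..t, v r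
  have hu' : ∀ t, u' t = u' 0 + ∫ r in (0 : ℝ)..t, v r := fun t => by simp [u']
  have e : ∀ s ∈ Icc 0 T, histSegment p u s = histSegment p u' s := fun s hs =>
    histSegment_congr fun σ hσ => hu _ ⟨by linarith [hs.1, hσ.1], by linarith [hs.2, hσ.2]⟩
  refine ⟨?_, ((hasDerivAt_histSegment hp hv hvp hu' t).hasDerivWithinAt).congr e (e t ht)⟩
  rw [e t ht]
  refine (hasWeakDeriv_segment hv hu' t).congr (histSegment_coeFn ?_).symm
    (histSegment_coeFn (memLp_segment hvp t)).symm
  exact memLp_restrict_of_continuousOn isCompact_Icc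
      ((continuous_of_eq_integral hv hu').comp (continuous_const_add t)).continuousOn

end Segment

/-! ### The operator matrix is densely defined -/

section Dense

variable {𝕜 : Type*} [RCLike 𝕜] {X : Type*} [NormedAddCommGroup X] [NormedSpace ℝ X]
  [NormedSpace 𝕜 X] [IsScalarTower ℝ 𝕜 X] {p : ENNReal} [Fact (1 ≤ p)]

/-- To approximate `(a, f)` with `a ∈ D(A)`, extend `f` by the constant `a` to `(0, 1]`: the
averages over `[σ, σ + h]` lie in `W^{1,p}`, converge to `f` as `h ↓ 0` and take the value `a`
at `0`. -/
theorem dense_delayDomain [CompleteSpace X] (hp : p ≠ ⊤) {A : X →ₗ.[𝕜] X}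
    (hA : Dense (A.domain : Set X)) : Dense (delayDomain (p := p) A : Set (X × HistLp X p)) := by
  rintro ⟨x, f⟩
  have hcl : IsClosed {x | (x, f) ∈ closure (delayDomain (p := p) A : Set (X × HistLp X p))} :=
    isClosed_closure.preimage (f := fun x => (x, f)) (by fun_prop)
  refine hA.induction (P := fun x => (x, f) ∈ closure (delayDomain (p := p) A : Set _)) ?_ hcl x
  intro a ha
  let v : ℝ → X := glue f (fun _ => a) 1
  have hvp : MemLp v p volume := memLp_glue (Lp.memLp f) continuousOn_const
  have hv : Integrable v := memLp_one_iff_integrable.1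
    (memLp_glue (memLp_one_iff_integrable.2 (integrable_histLp f)) continuousOn_const)
  let u : ℝ → X := fun t => ∫ r in (0 : ℝ)..t, v r
  have hu : ∀ t, u t = u 0 + ∫ r in (0 : ℝ)..t, v r := fun t => by simp [u]
  have huc := continuous_of_eq_integral hv hu
  have hseg : ∀ t, histSegment p u t =ᵐ[histMeasure] fun σ => u (t + σ) := fun t =>
    histSegment_coeFn (memLp_restrict_of_continuousOn isCompact_Icc
      (huc.comp (continuous_const_add t)).continuousOn)
  have hv0 : histSegment p v 0 = f := by
    rw [histSegment_eq_iff (memLp_segment hvp 0)]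
    refine ae_histMeasure_of_forall_Ioo (Eventually.of_forall fun σ hσ => ?_)
    have h1 : σ ∈ Icc (-1 : ℝ) 0 := Ioo_subset_Icc_self hσ
    have h2 : σ ∉ Ioc (0 : ℝ) 1 := fun h => lt_asymm hσ.2 h.1
    simp [v, glue, indicator_of_mem h1, indicator_of_notMem h2]
  have hd := (hasDerivAt_iff_tendsto_slope.1 (hasDerivAt_histSegment hp hv hvp hu 0)).mono_left
    (nhdsWithin_mono 0 (fun h (hh : h ∈ Ioi (0 : ℝ)) => ne_of_gt hh))
  rw [hv0] at hd
  refine mem_closure_of_tendsto (tendsto_const_nhds.prodMk_nhds hd) ?_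
  have hw : ∀ t, (histSegment p u t, histSegment p v t) ∈ sobolev 𝕜 X p := fun t =>
    (hasWeakDeriv_segment hv hu t).congr (hseg t).symm
      (histSegment_coeFn (memLp_segment hvp t)).symm
  filter_upwards [Ioc_mem_nhdsGT (zero_lt_one' ℝ)] with h hh
  have e : slope (histSegment p u) 0 h = h⁻¹ • (histSegment p u h - histSegment p u 0) := by
    simp [slope_def_module]
  refine ⟨ha, ?_, fun σ => h⁻¹ • (u (h + σ) - u σ), by fun_prop, ?_, ?_⟩
  · simp only [e]
    exact Submodule.smul_of_tower_mem _ h⁻¹ (sub_mem ⟨⟨_, hw h⟩, rfl⟩ ⟨⟨_, hw 0⟩, rfl⟩)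
  · simp only [e]
    filter_upwards [Lp.coeFn_smul h⁻¹ (histSegment p u h - histSegment p u 0),
      Lp.coeFn_sub (histSegment p u h) (histSegment p u 0), hseg h, hseg 0] with σ h1 h2 h3 h4
    rw [h1, Pi.smul_apply, h2, Pi.sub_apply, h3, h4, zero_add]
  · have e1 : u h = h • a := by
      simp only [u, v]
      rw [integral_glue_of_nonneg _ _ ⟨hh.1.le, hh.2⟩]
      simp
    have e2 : u 0 = 0 := by simp [u]
    simp only [add_zero, e1, e2, sub_zero]
    rw [inv_smul_smul₀ (ne_of_gt hh.1)]

end Dense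

/-! ### Classical solutions as solutions of the abstract Cauchy problem -/

section ToCauchy

variable {𝕜 : Type*} [RCLike 𝕜] {X : Type*} [NormedAddCommGroup X] [NormedSpace ℝ X]
  [NormedSpace 𝕜 X] [IsScalarTower ℝ 𝕜 X] {p : ENNReal} [Fact (1 ≤ p)]

/-- The pair of the current value and the history segment of a classical solution solves the abstract
Cauchy problem. -/
theorem IsClassicalSolution.isStrictSolution [CompleteSpace X] (hp : p ≠ ⊤) {A : X →ₗ.[𝕜] X}
    {Φ : sobolev 𝕜 X p →L[𝕜] X} {z : X × HistLp X p} {u : ℝ → X}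
    (h : IsClassicalSolution A Φ z u) :
    ∃ V, IsStrictSolution (delayOperator A Φ) z (fun t => (u t, histSegment p u t)) V := by
  obtain ⟨-, w₀, -, hw₀, -⟩ := h.equation 0 le_rfl
  simp only [zero_add] at hw₀
  let g : HistLp X p := w₀.1.2
  let u' : ℝ → X := derivWithin u (Ici 0)
  have hu' : ContinuousOn u' (Ici 0) :=
    h.contDiffOn.continuousOn_derivWithin (uniqueDiffOn_Ici 0) le_rfl
  have hd : ∀ t, 0 ≤ t → HasDerivWithinAt u (u' t) (Ici 0) t := fun t ht =>
    (h.contDiffOn.differentiableOn one_ne_zero t ht).hasDerivWithinAt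
  have hu0 : ∀ σ ∈ Icc (-1 : ℝ) 0, u σ = u 0 + ∫ s in (0 : ℝ)..σ, g s :=
    HasWeakDeriv.eq_integral_of_continuousOn (integrable_histLp w₀.1.1) (integrable_histLp g) w₀.2
      (h.continuousOn.mono fun σ hσ => hσ.1) hw₀.symm
  have huT : ∀ T, ∀ t ∈ Icc (-1) T, u t = u 0 + ∫ s in (0 : ℝ)..t, glue g u' T s := by
    intro T t ht
    rcases le_total t 0 with h0 | h0
    · rw [integral_glue_of_nonpos _ _ _ ⟨ht.1, h0⟩]
      exact hu0 t ⟨ht.1, h0⟩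
    · rw [integral_glue_of_nonneg _ _ ⟨h0, ht.2⟩,
        integral_eq_sub_of_hasDerivWithinAt_Ici hu' hd le_rfl h0]
      abel
  have hu'T : ∀ T, ContinuousOn u' (Icc 0 T) := fun T => hu'.mono fun t ht => ht.1
  have hvp : ∀ T, MemLp (glue g u' T) p volume := fun T => memLp_glue (Lp.memLp g) (hu'T T)
  have hv : ∀ T, Integrable (glue g u' T) := fun T => memLp_one_iff_integrable.1
    (memLp_glue (memLp_one_iff_integrable.2 (integrable_histLp g)) (hu'T T))
  -- the cutoff time of `glue` is irrelevant for `V₂ t` as long as it is at least `t`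
  let V₂ : ℝ → HistLp X p := fun t => histSegment p (glue g u' t) t
  have hV₂ : ∀ T, ∀ t ∈ Icc 0 T, V₂ t = histSegment p (glue g u' T) t := by
    intro T t ht
    refine histSegment_congr fun σ hσ => ?_
    have e : t + σ ∈ Ioc 0 t ↔ t + σ ∈ Ioc 0 T := by
      simp only [mem_Ioc]
      exact ⟨fun h => ⟨h.1, h.2.trans ht.2⟩, fun h => ⟨h.1, by linarith [hσ.2]⟩⟩
    have e' : indicator (Ioc 0 t) u' (t + σ) = indicator (Ioc 0 T) u' (t + σ) := by
      by_cases h : t + σ ∈ Ioc 0 t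
      · rw [indicator_of_mem h, indicator_of_mem (e.1 h)]
      · rw [indicator_of_notMem h, indicator_of_notMem (mt e.2 h)]
    simp only [glue, e']
  have hnhds : ∀ t : ℝ, 0 ≤ t → Icc 0 (t + 1) ∈ 𝓝[Ici 0] t := fun t _ => by
    rw [← Ici_inter_Iic]
    exact inter_mem_nhdsWithin _ (Iic_mem_nhds (lt_add_one t))
  have hdw := fun t (ht : 0 ≤ t) => hasDerivWithinAt_histSegment (p := p) hp (hv (t + 1))
    (hvp (t + 1)) (huT (t + 1)) (t := t) ⟨ht, (lt_add_one t).le⟩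
  have hmem : ∀ t, 0 ≤ t → MemLp (fun σ => u (t + σ)) p histMeasure := fun t ht =>
    memLp_segment_of_continuousOn h.continuousOn ht
  refine ⟨fun t => (u' t, V₂ t), ?_, fun t ht => ?_, fun t ht => ?_, ?_⟩
  · refine Prod.ext h.initial_value ?_
    rw [histSegment_eq_iff (hmem 0 le_rfl)]
    simpa using h.initial_history.symm
  · obtain ⟨a, w, ha, hw, haw⟩ := h.equation t ht
    obtain ⟨hweak, -⟩ := hdw t ht
    rw [← hV₂ (t + 1) t ⟨ht, (lt_add_one t).le⟩] at hweak
    let w' : sobolev 𝕜 X p := ⟨(histSegment p u t, V₂ t), hweak⟩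
    have hww' : w = w' := by
      refine sobolevToLp_injective ?_
      symm
      exact (histSegment_eq_iff (hmem t ht)).2 hw
    have e : u' t = A a + Φ w := haw.derivWithin (uniqueDiffOn_Ici 0 t ht)
    refine mem_graph_delayOperator_iff.2 ⟨a, w, ha, by rw [hww']; rfl, ?_, ?_⟩
    · refine ⟨fun σ => u (t + σ), h.continuousOn.comp (by fun_prop) fun σ hσ => ?_,
        (histSegment_coeFn (hmem t ht)).symm, by simp⟩
      exact mem_Ici.2 (by linarith [hσ.1])
    · rw [← e, hww']
      rfl
  · have h2 := (hdw t ht).2.mono_of_mem_nhdsWithin (hnhds t ht)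
    rw [← hV₂ (t + 1) t ⟨ht, (lt_add_one t).le⟩] at h2
    exact (hd t ht).prodMk h2
  · refine hu'.prodMk fun t ht => ?_
    have h1 : ContinuousWithinAt (histSegment p (glue g u' (t + 1))) (Ici 0) t :=
      (continuous_histSegment hp (hvp (t + 1))).continuousWithinAt
    refine h1.congr_of_eventuallyEq ?_ (hV₂ _ t ⟨ht, (lt_add_one t).le⟩)
    filter_upwards [hnhds t ht] with s hs using hV₂ _ s hs

end ToCauchy

/-! ### Solutions of the abstract Cauchy problem are translations -/

section FromCauchy

/-- The translate `σ ↦ φ (σ + t)` of a compactly supported function, as a bounded function. -/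
noncomputable def translate (φ : ℝ → ℝ) (hφ : Continuous φ) (hc : HasCompactSupport φ) (t : ℝ) :
    BoundedContinuousFunction ℝ ℝ :=
  BoundedContinuousFunction.ofNormedAddCommGroup (fun σ => φ (σ + t)) (by fun_prop)
    (hc.exists_bound_of_continuous hφ).choose
    (fun σ => (hc.exists_bound_of_continuous hφ).choose_spec (σ + t))

theorem translate_apply {φ : ℝ → ℝ} (hφ : Continuous φ) (hc : HasCompactSupport φ) (t σ : ℝ) :
    translate φ hφ hc t σ = φ (σ + t) := rfl

/-- Translates of a test function are differentiable in the supremum norm. -/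
theorem hasDerivAt_translate {φ : ℝ → ℝ} (hφ : ContDiff ℝ ∞ φ) (hc : HasCompactSupport φ) (t : ℝ) :
    HasDerivAt (translate φ hφ.continuous hc)
      (translate (deriv φ) (hφ.continuous_deriv (by simp)) hc.deriv t) t := by
  have hφ' : ContDiff ℝ ∞ (deriv φ) := (contDiff_infty_iff_deriv.1 hφ).2
  obtain ⟨K, hK⟩ := hc.deriv.deriv.exists_bound_of_continuous (hφ'.continuous_deriv (by simp))
  have hK0 : 0 ≤ K := (norm_nonneg _).trans (hK 0)
  have hd : ∀ x, HasDerivAt φ (deriv φ x) x := fun x =>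
    (hφ.differentiable (by simp)).differentiableAt.hasDerivAt
  have hlip : ∀ x y, ‖deriv φ y - deriv φ x‖ ≤ K * ‖y - x‖ := fun x y =>
    Convex.norm_image_sub_le_of_norm_deriv_le (s := univ)
      (fun z _ => (hφ'.differentiable (by simp)).differentiableAt) (fun z _ => hK z) convex_univ
      (mem_univ _) (mem_univ _)
  have htaylor : ∀ x y, ‖φ y - φ x - (y - x) * deriv φ x‖ ≤ K * ‖y - x‖ * ‖y - x‖ := by
    intro x y
    have := Convex.norm_image_sub_le_of_norm_hasDerivWithin_le (s := uIcc x y) (x := x) (y := y)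
      (f := fun r => φ r - (r - x) * deriv φ x) (f' := fun r => deriv φ r - deriv φ x)
      (C := K * ‖y - x‖) (fun r _ => by
        have h1 := ((hasDerivAt_id r).sub_const x).mul_const (deriv φ x)
        rw [one_mul] at h1
        exact ((hd r).sub h1).hasDerivWithinAt) (fun r hr => by
        refine (hlip x r).trans ?_
        gcongr
        rw [Real.norm_eq_abs, Real.norm_eq_abs]
        exact abs_sub_left_of_mem_uIcc hr) (convex_uIcc x y) left_mem_uIcc right_mem_uIcc
    have e : φ y - (y - x) * deriv φ x - (φ x - (x - x) * deriv φ x) =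
        φ y - φ x - (y - x) * deriv φ x := by ring
    rwa [e] at this
  rw [hasDerivAt_iff_isLittleO]
  have hbig : (fun s => translate φ hφ.continuous hc s - translate φ hφ.continuous hc t -
      (s - t) • translate (deriv φ) (hφ.continuous_deriv (by simp)) hc.deriv t) =O[𝓝 t]
      fun s => ‖s - t‖ ^ 2 := by
    refine Asymptotics.IsBigO.of_bound K (Eventually.of_forall fun s => ?_)
    refine (BoundedContinuousFunction.norm_le (by positivity)).2 fun σ => ?_
    have h1 := htaylor (σ + t) (σ + s)
    rw [add_sub_add_left_eq_sub] at h1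
    refine h1.trans (le_of_eq ?_)
    rw [norm_pow, norm_norm]
    ring
  exact hbig.trans_isLittleO (Asymptotics.isLittleO_pow_sub_sub t one_lt_two)

variable {𝕜 : Type*} [RCLike 𝕜] {X : Type*} [NormedAddCommGroup X] [NormedSpace ℝ X]
  [NormedSpace 𝕜 X] [IsScalarTower ℝ 𝕜 X] {p : ENNReal} [Fact (1 ≤ p)]

/-- If `F' = dF/dσ` in `L^p([-1,0], X)` with boundary value `F(t)(0) = x(t)`, then `F(t)` is the
history segment at time `t` of the function which is `F(0)` on `[-1, 0]` and `x` on `[0, ∞)`: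
for a test function `φ`, the pairing of `F(t)` with `φ(· + t - T)` has derivative
`φ(t - T) x(t)`. -/
theorem eq_histSegment_of_transport [CompleteSpace X] {F F' : ℝ → HistLp X p} {u : ℝ → X}
    (hu : ContinuousOn u (Ici (-1))) (hF0 : u =ᵐ[histMeasure] F 0)
    (hweak : ∀ t, 0 ≤ t → HasWeakDeriv (F t) (F' t))
    (hval : ∀ t, 0 ≤ t → HasValueAtZero (F t) (u t))
    (hd : ∀ t, 0 ≤ t → HasDerivWithinAt F (F' t) (Ici 0) t) {T : ℝ} (hT : 0 ≤ T) :
    F T = histSegment p u T := by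
  have hmem : MemLp (fun σ => u (T + σ)) p histMeasure := memLp_segment_of_continuousOn hu hT
  symm
  rw [histSegment_eq_iff hmem]
  refine ae_eq_of_integral_test_eq (integrable_histLp _) (hmem.integrable Fact.out) ?_
  intro φ hφ hc hs
  have hφ0 : ∀ x, x ∉ Ioo (-1 : ℝ) 0 → φ x = 0 := fun x hx =>
    image_eq_zero_of_notMem_tsupport fun h => hx (hs h)
  have hdφ : ∀ x, HasDerivAt φ (deriv φ x) x := fun x =>
    (hφ.differentiable (by simp)).differentiableAt.hasDerivAt
  have hφ'c : Continuous (deriv φ) := hφ.continuous_deriv (by simp)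
  let c : ℝ → BoundedContinuousFunction ℝ ℝ := fun t => translate φ hφ.continuous hc (t - T)
  let c' : ℝ → BoundedContinuousFunction ℝ ℝ := fun t => translate (deriv φ) hφ'c hc.deriv (t - T)
  have hcd : ∀ t, HasDerivAt c (c' t) t := fun t => by
    simpa using! (hasDerivAt_translate hφ hc (t - T)).scomp t ((hasDerivAt_id t).sub_const T)
  have hD : ∀ t ∈ Icc 0 T, HasDerivWithinAt (fun s => histPairing X p (c s) (F s))
      (φ (t - T) • u t) (Ici 0) t := by
    intro t ht
    have h1 := (histPairing X p).hasDerivWithinAt_of_bilinear (hcd t).hasDerivWithinAt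
      (hd t ht.1)
    convert! h1 using 1
    obtain ⟨G, hG, hGF, hG0⟩ := hval t ht.1
    have h2 := integral_smul_add_integral_deriv_smul (integrable_histLp (F' t))
      ((hweak t ht.1).eq_integral_of_continuousOn (integrable_histLp _) (integrable_histLp _)
        hG hGF) (φ := fun σ => φ (σ + (t - T))) (φ' := fun σ => deriv φ (σ + (t - T)))
      (fun s => (hdφ _).comp_add_const s (t - T)) (by fun_prop)
    rw [hφ0 (-1 + (t - T)) (fun h => by linarith [h.1, ht.2]), zero_smul, sub_zero, zero_add,
      hG0] at h2
    rw [← h2]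
    congr 1
    refine integral_congr_ae ?_
    filter_upwards [hGF] with σ hσ
    rw [hσ]
    rfl
  have hcont : ContinuousOn (fun s => φ (s - T) • u s) (Ici (-1)) :=
    (hφ.continuous.comp (by fun_prop)).continuousOn.smul hu
  have hii : ∀ a b, -1 ≤ a → -1 ≤ b →
      IntervalIntegrable (fun s => φ (s - T) • u s) volume a b := fun a b ha hb =>
    (hcont.mono fun s hs => (le_min ha hb).trans hs.1).intervalIntegrable
  have hint : ∫ s in (0 : ℝ)..T, φ (s - T) • u s =
      histPairing X p (c T) (F T) - histPairing X p (c 0) (F 0) := by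
    refine intervalIntegral.integral_eq_sub_of_hasDeriv_right_of_le hT
      (fun s hs => (hD s hs).continuousWithinAt.mono fun r hr => hr.1)
      (fun s hs => (hD s ⟨hs.1.le, hs.2.le⟩).mono fun r hr => hs.1.le.trans (le_of_lt hr))
      (hii 0 T (by norm_num) (by linarith))
  have e1 : histPairing X p (c T) (F T) = ∫ σ, φ σ • F T σ ∂histMeasure := by
    refine integral_congr_ae (Eventually.of_forall fun σ => ?_)
    simp [c, translate_apply]
  have e2 : histPairing X p (c 0) (F 0) = ∫ s in (-1 : ℝ)..0, φ (s - T) • u s := by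
    rw [← integral_histMeasure]
    refine integral_congr_ae ?_
    filter_upwards [hF0] with σ hσ
    rw [hσ]
    simp [c, translate_apply, sub_eq_add_neg]
  have e3 : ∫ σ, φ σ • u (T + σ) ∂histMeasure = ∫ s in (T - 1)..T, φ (s - T) • u s := by
    rw [integral_histMeasure]
    have := intervalIntegral.integral_comp_add_left (a := -1) (b := 0)
      (fun s => φ (s - T) • u s) T
    simpa [← sub_eq_add_neg] using this
  have e4 : ∫ s in (-1)..(T - 1), φ (s - T) • u s = 0 := by
    refine intervalIntegral.integral_zero_ae (Eventually.of_forall fun s hs => ?_)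
    rw [uIoc_of_le (by linarith)] at hs
    rw [hφ0 _ (fun h => by linarith [h.1, hs.2]), zero_smul]
  rw [← e1, e3]
  have e5 := intervalIntegral.integral_add_adjacent_intervals
    (hii (-1) (T - 1) le_rfl (by linarith)) (hii (T - 1) T (by linarith) (by linarith))
  have e6 := intervalIntegral.integral_add_adjacent_intervals
    (hii (-1) 0 le_rfl (by norm_num)) (hii 0 T (by norm_num) (by linarith))
  rw [e4, zero_add] at e5
  rw [e5, ← e6, hint, e2]
  abel

/-- Every solution of the abstract Cauchy problem comes from a classical solution of the delay
equation. -/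
theorem IsStrictSolution.exists_isClassicalSolution [CompleteSpace X] {A : X →ₗ.[𝕜] X}
    {Φ : sobolev 𝕜 X p →L[𝕜] X} {z : X × HistLp X p} {U V : ℝ → X × HistLp X p}
    (h : IsStrictSolution (delayOperator A Φ) z U V) :
    ∃ u, IsClassicalSolution A Φ z u ∧ ∀ t, 0 ≤ t → U t = (u t, histSegment p u t) := by
  choose! a w ha hw hv hV using fun t (ht : 0 ≤ t) =>
    mem_graph_delayOperator_iff.1 (h.mem_graph t ht)
  obtain ⟨F₀, hF₀, hF₀z, hF₀0⟩ := hv 0 le_rfl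
  let u : ℝ → X := fun s => if s ≤ 0 then F₀ s else (U s).1
  have hu1 : ∀ s ≤ 0, u s = F₀ s := fun s hs => if_pos hs
  have hu2 : ∀ s, 0 ≤ s → u s = (U s).1 := by
    intro s hs
    rcases hs.eq_or_lt with rfl | hs
    · rw [hu1 0 le_rfl, hF₀0]
    · exact if_neg (not_le.2 hs)
  have hd1 : ∀ t, 0 ≤ t → HasDerivWithinAt u (V t).1 (Ici 0) t := fun t ht =>
    ((ContinuousLinearMap.fst ℝ X (HistLp X p)).hasFDerivAt.comp_hasDerivWithinAt t
      (h.hasDeriv t ht)).congr (fun s hs => hu2 s hs) (hu2 t ht)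
  have hd2 : ∀ t, 0 ≤ t → HasDerivWithinAt (fun t => (U t).2) (V t).2 (Ici 0) t := fun t ht =>
    (ContinuousLinearMap.snd ℝ X (HistLp X p)).hasFDerivAt.comp_hasDerivWithinAt t
      (h.hasDeriv t ht)
  have huc : ContinuousOn u (Ici (-1)) := by
    have h1 : ContinuousOn u (Icc (-1) 0) := hF₀.congr fun s hs => hu1 s hs.2
    have h2 : ContinuousOn u (Ici 0) := fun t ht => (hd1 t ht).continuousWithinAt
    rw [← Icc_union_Ici_eq_Ici (show (-1 : ℝ) ≤ 0 by norm_num)]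
    exact h1.union_of_isClosed h2 isClosed_Icc isClosed_Ici
  have hu0 : u =ᵐ[histMeasure] (U 0).2 := by
    filter_upwards [hF₀z, ae_restrict_mem measurableSet_Icc] with σ h1 h2
    rw [hu1 σ h2.2, h1]
  have hweak : ∀ t, 0 ≤ t → HasWeakDeriv (U t).2 (V t).2 := by
    intro t ht
    have h1 : HasWeakDeriv (w t).1.1 (w t).1.2 := (w t).2
    have e1 : (w t).1.1 = (U t).2 := hw t ht
    have e2 : (w t).1.2 = (V t).2 := by rw [hV t ht]; rfl
    rwa [e1, e2] at h1
  have hseg : ∀ t, 0 ≤ t → (U t).2 = histSegment p u t := fun t ht =>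
    eq_histSegment_of_transport (F := fun t => (U t).2) (F' := fun t => (V t).2) huc hu0 hweak
      (fun t ht => by rw [hu2 t ht]; exact hv t ht) hd2 ht
  refine ⟨u, ⟨huc, ?_, fun t ht => ?_, ?_, ?_⟩, fun t ht => Prod.ext (hu2 t ht).symm (hseg t ht)⟩
  · rw [contDiffOn_one_iff_derivWithin (uniqueDiffOn_Ici 0)]
    refine ⟨fun t ht => (hd1 t ht).differentiableWithinAt, ?_⟩
    exact (continuous_fst.comp_continuousOn h.continuousOn_deriv).congr fun t ht =>
      (hd1 t ht).derivWithin (uniqueDiffOn_Ici 0 t ht)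
  · refine ⟨a t, w t, by rw [ha t ht, hu2 t ht], ?_, ?_⟩
    · rw [hw t ht, hseg t ht]
      exact histSegment_coeFn (memLp_segment_of_continuousOn huc ht)
    · have h1 := hd1 t ht
      rwa [hV t ht] at h1
  · rw [hu2 0 le_rfl, h.initial]
  · rwa [h.initial] at hu0

end FromCauchy

/-! ### Well-posedness of the delay equation and of the abstract Cauchy problem -/

section Equivalence

theorem norm_histSegment_le {X : Type*} [NormedAddCommGroup X] {p : ENNReal} [Fact (1 ≤ p)]
    {u : ℝ → X} (hu : ContinuousOn u (Ici (-1))) {f : HistLp X p} (hf : u =ᵐ[histMeasure] f)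
    {t C : ℝ} (ht : 0 ≤ t) (hC : ∀ s ∈ Icc 0 t, ‖u s‖ ≤ C) :
    ‖histSegment p u t‖ ≤ ‖f‖ + C := by
  have hC0 : 0 ≤ C := (norm_nonneg _).trans (hC 0 ⟨le_rfl, ht⟩)
  let w₁ : ℝ → X := indicator (Icc (-1) 0) u
  let w₂ : ℝ → X := indicator (Ioc 0 t) u
  have hw₁ : MemLp w₁ p volume := by
    rw [memLp_indicator_iff_restrict measurableSet_Icc]
    exact (Lp.memLp f).ae_eq hf.symm
  have hw₂ : MemLp w₂ p volume := by
    rw [memLp_indicator_iff_restrict measurableSet_Ioc]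
    exact (memLp_restrict_of_continuousOn isCompact_Icc
      (hu.mono fun s (hs : s ∈ Icc (-1) t) => hs.1)).mono_measure
      (Measure.restrict_mono (show Ioc 0 t ⊆ Icc (-1) t from
        fun s hs => ⟨by linarith [hs.1], hs.2⟩) le_rfl)
  have e : ∀ σ ∈ Icc (-1 : ℝ) 0, u (t + σ) = w₁ (t + σ) + w₂ (t + σ) := by
    intro σ hσ
    rcases le_or_gt (t + σ) 0 with h0 | h0
    · have h1 : t + σ ∈ Icc (-1 : ℝ) 0 := ⟨by linarith [hσ.1], h0⟩
      have h2 : t + σ ∉ Ioc 0 t := fun h => not_lt.2 h0 h.1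
      simp [w₁, w₂, indicator_of_mem h1, indicator_of_notMem h2]
    · have h1 : t + σ ∉ Icc (-1 : ℝ) 0 := fun h => not_lt.2 h.2 h0
      have h2 : t + σ ∈ Ioc 0 t := ⟨h0, by linarith [hσ.2]⟩
      simp [w₁, w₂, indicator_of_mem h2, indicator_of_notMem h1]
  have h1 : ‖histSegment p w₁ t‖ ≤ ‖f‖ := by
    rw [Lp.norm_def, Lp.norm_def]
    refine ENNReal.toReal_mono (Lp.eLpNorm_ne_top f) ?_
    calc eLpNorm (histSegment p w₁ t) p histMeasure
        = eLpNorm (fun σ => w₁ (t + σ)) p histMeasure :=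
          eLpNorm_congr_ae (histSegment_coeFn (memLp_segment hw₁ t))
      _ ≤ eLpNorm (fun σ => w₁ (t + σ)) p volume := eLpNorm_mono_measure _ Measure.restrict_le_self
      _ = eLpNorm w₁ p volume := eLpNorm_comp_measurePreserving (f := fun σ => t + σ) (g := w₁)
          hw₁.aestronglyMeasurable (measurePreserving_add_left volume t)
      _ = eLpNorm u p histMeasure := eLpNorm_indicator_eq_eLpNorm_restrict measurableSet_Icc
      _ = eLpNorm f p histMeasure := eLpNorm_congr_ae hf
  have h2 : ‖histSegment p w₂ t‖ ≤ C := by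
    have h3 : ∀ σ, ‖w₂ (t + σ)‖ ≤ C := by
      intro σ
      by_cases hσ : t + σ ∈ Ioc 0 t
      · rw [show w₂ (t + σ) = u (t + σ) from indicator_of_mem hσ _]
        exact hC _ ⟨hσ.1.le, hσ.2⟩
      · rw [show w₂ (t + σ) = 0 from indicator_of_notMem hσ _, norm_zero]
        exact hC0
    rw [Lp.norm_def, eLpNorm_congr_ae (histSegment_coeFn (memLp_segment hw₂ t))]
    refine ENNReal.toReal_le_of_le_ofReal hC0
      ((eLpNorm_le_of_ae_bound (Eventually.of_forall h3)).trans ?_)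
    simp
  have e2 : histSegment p u t = histSegment p w₁ t + histSegment p w₂ t := by
    rw [histSegment_eq_iff (memLp_segment_of_continuousOn hu ht)]
    filter_upwards [Lp.coeFn_add (histSegment p w₁ t) (histSegment p w₂ t),
      histSegment_coeFn (memLp_segment hw₁ t), histSegment_coeFn (memLp_segment hw₂ t),
      ae_histMeasure_of_forall e] with σ h3 h4 h5 h6
    rw [h3, Pi.add_apply, h4, h5, h6]
  rw [e2]
  exact (norm_add_le _ _).trans (add_le_add h1 h2)

variable {𝕜 : Type*} [RCLike 𝕜] {X : Type*} [NormedAddCommGroup X] [NormedSpace ℝ X]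
  [NormedSpace 𝕜 X] [IsScalarTower ℝ 𝕜 X] [CompleteSpace X] {p : ENNReal} [Fact (1 ≤ p)]
  {A : X →ₗ.[𝕜] X} {Φ : sobolev 𝕜 X p →L[𝕜] X}

/-- Continuous dependence on the data, stated for sequences, gives a bound by linearity: otherwise
suitably normalized solutions have data tending to `0` but do not tend to `0` uniformly. -/
theorem WellPosed.exists_norm_fst_le (h : WellPosed A Φ) (b : ℝ) :
    ∃ K, 0 ≤ K ∧ ∀ z U V, IsStrictSolution (delayOperator A Φ) z U V →
      ∀ t ∈ Icc 0 b, ‖(U t).1‖ ≤ K * ‖z‖ := by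
  by_contra! hcon
  choose z U V hUV t ht hlt using fun n : ℕ => hcon (n + 1) (by positivity)
  have hpos : ∀ n, 0 < ‖(U n (t n)).1‖ := fun n => lt_of_le_of_lt (by positivity) (hlt n)
  let c : ℕ → 𝕜 := fun n => ((‖(U n (t n)).1‖⁻¹ : ℝ) : 𝕜)
  have hc : ∀ n, ‖c n‖ = ‖(U n (t n)).1‖⁻¹ := fun n => by
    rw [RCLike.norm_ofReal, abs_of_pos (inv_pos.2 (hpos n))]
  choose us hus hUus using fun n => ((hUV n).const_smul (c n)).exists_isClassicalSolution
  have hzero : IsStrictSolution (delayOperator A Φ) 0 (fun _ => 0) (fun _ => 0) :=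
    ⟨rfl, fun _ _ => zero_mem _, fun _ _ => hasDerivWithinAt_const _ _ _, continuousOn_const⟩
  obtain ⟨u₀, hu₀, hu₀'⟩ := hzero.exists_isClassicalSolution
  have hdom : ∀ n, c n • z n ∈ delayDomain (p := p) A := fun n => by
    have h1 := ((hUV n).const_smul (c n)).mem_domain le_rfl
    rwa [((hUV n).const_smul (c n)).initial] at h1
  have hlim : Tendsto (fun n => c n • z n) atTop (𝓝 0) := by
    refine squeeze_zero_norm (fun n => ?_) tendsto_one_div_add_atTop_nhds_zero_nat
    rw [norm_smul, hc, inv_mul_le_iff₀ (hpos n), mul_one_div, le_div_iff₀ (by positivity), mul_comm]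
    exact (hlt n).le
  have hunif := h.continuous_dependence _ 0 us u₀ hdom (zero_mem _) hlim hus hu₀ 0 b le_rfl
  obtain ⟨n, hn⟩ := ((Metric.tendstoUniformlyOn_iff.1 hunif) 1 one_pos).exists
  have h1 := hn (t n) (ht n)
  have e1 : u₀ (t n) = 0 := (congrArg Prod.fst (hu₀' (t n) (ht n).1)).symm
  have e2 : us n (t n) = c n • (U n (t n)).1 :=
    (congrArg Prod.fst (hUus n (t n) (ht n).1)).symm
  rw [e1, e2, dist_zero_left, norm_smul, hc, inv_mul_cancel₀ (hpos n).ne'] at h1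
  exact lt_irrefl _ h1

theorem WellPosed.generatesC0Semigroup (hp : p ≠ ⊤) (hA : A.IsClosed)
    (hA' : Dense (A.domain : Set X)) (h : WellPosed A Φ) :
    GeneratesC0Semigroup (delayOperator A Φ) := by
  refine generatesC0Semigroup_of_isStrictSolution (isClosed_delayOperator hA Φ)
    (dense_delayDomain hp hA') ?_ ?_ ?_
  · intro z hz
    obtain ⟨u, hu⟩ := h.existence z hz
    obtain ⟨V, hV⟩ := hu.isStrictSolution hp
    exact ⟨_, V, hV⟩
  · intro z U V U' V' hU hU' t ht
    have hz : z ∈ delayDomain (p := p) A := by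
      have h1 := hU.mem_domain le_rfl
      rwa [hU.initial] at h1
    obtain ⟨u, hu, hUu⟩ := hU.exists_isClassicalSolution
    obtain ⟨u', hu', hUu'⟩ := hU'.exists_isClassicalSolution
    have he := h.uniqueness z hz u u' hu hu'
    have ht : 0 ≤ t := ht
    rw [hUu t ht, hUu' t ht, he (mem_Ici.2 (by linarith)), histSegment_congr fun σ hσ =>
      he (mem_Ici.2 (by linarith [hσ.1]))]
  · intro b
    obtain ⟨K, hK0, hK⟩ := h.exists_norm_fst_le b
    refine ⟨1 + K, fun z U V hU t ht => ?_⟩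
    obtain ⟨u, hu, hUu⟩ := hU.exists_isClassicalSolution
    have hub : ∀ s ∈ Icc 0 t, ‖u s‖ ≤ K * ‖z‖ := by
      intro s hs
      have h1 := hK z U V hU s ⟨hs.1, hs.2.trans ht.2⟩
      rwa [hUu s hs.1] at h1
    have h1 := norm_histSegment_le hu.continuousOn hu.initial_history ht.1 hub
    have h2 := hub t ⟨ht.1, le_rfl⟩
    have h3 : ‖z.2‖ ≤ ‖z‖ := norm_snd_le z
    rw [hUu t ht.1, Prod.norm_def]
    refine max_le ?_ ?_ <;> simp only <;> nlinarith [norm_nonneg z]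

theorem GeneratesC0Semigroup.wellPosed (hp : p ≠ ⊤)
    (h : GeneratesC0Semigroup (delayOperator A Φ)) : WellPosed A Φ := by
  obtain ⟨T, hT, hB⟩ := h
  have hsol : ∀ z u, IsClassicalSolution A Φ z u → ∀ t, 0 ≤ t → u t = (T t z).1 := by
    intro z u hu t ht
    obtain ⟨V, hV⟩ := hu.isStrictSolution hp
    exact congrArg Prod.fst (hT.eq_apply_of_isStrictSolution hB hV ht)
  refine ⟨fun z hz => ?_, fun z _ u v hu hv => ?_, ?_⟩
  · obtain ⟨u, hu, -⟩ := (hT.isStrictSolution_orbit hB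
      (LinearPMap.mem_graph (delayOperator A Φ) ⟨z, hz⟩)).exists_isClassicalSolution
    exact ⟨u, hu⟩
  · intro t ht
    rcases le_total 0 t with h0 | h0
    · rw [hsol z u hu t h0, hsol z v hv t h0]
    · exact eqOn_of_ae_eq_histMeasure (hu.continuousOn.mono fun s hs => hs.1)
        (hv.continuousOn.mono fun s hs => hs.1)
        (hu.initial_history.trans hv.initial_history.symm) ⟨ht, h0⟩
  · intro zs z us u _ _ hlim hus hu a b ha
    obtain ⟨M, hM0, hM⟩ := hT.exists_norm_le b
    rw [Metric.tendstoUniformlyOn_iff]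
    intro ε hε
    have h1 : Tendsto (fun n => M * ‖zs n - z‖) atTop (𝓝 0) := by
      simpa using (tendsto_iff_norm_sub_tendsto_zero.1 hlim).const_mul M
    filter_upwards [h1.eventually (gt_mem_nhds hε)] with n hn t ht
    have ht0 : 0 ≤ t := ha.trans ht.1
    rw [dist_comm, dist_eq_norm, hsol _ _ (hus n) t ht0, hsol _ _ hu t ht0, ← Prod.fst_sub,
      ← map_sub]
    exact (norm_fst_le _).trans_lt (((T t).le_of_opNorm_le (hM t ⟨ht0, ht.2⟩) _).trans_lt hn)

end Equivalence

end DelayEq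

theorem theorem2p7 {𝕜 : Type*} [RCLike 𝕜] {X : Type*} [NormedAddCommGroup X] [NormedSpace ℝ X]
    [NormedSpace 𝕜 X] [IsScalarTower ℝ 𝕜 X] [CompleteSpace X]
    (p : ENNReal) [Fact (1 ≤ p)] (hp : p ≠ ⊤)
    (A : X →ₗ.[𝕜] X) (hA_closed : A.IsClosed) (hA_dense : Dense (A.domain : Set X))
    (Φ : DelayEq.sobolev 𝕜 X p →L[𝕜] X) :
    DelayEq.WellPosed A Φ ↔ DelayEq.GeneratesC0Semigroup (DelayEq.delayOperator A Φ) :=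
  ⟨fun h => h.generatesC0Semigroup hp hA_closed hA_dense, fun h => h.wellPosed hp⟩
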